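/- Let $m\ge 3$ and $n\ge 1$ be integers and let $A$ be an $n\times n$ complex matrix. Let $\mathcal K_m(A)$ be the $mn\times mn$ block matrix, with $n\times n$ blocks indexed by $1\le i,j\le m$, whose $(i,j)$ block is $A^{\,j-i}$ if $i<j$ and $0$ if $i\ge j$. For a square complex matrix $X$, write $X^*$ for its conjugate transpose, $\mathrm{Re}(X)=\frac12(X+X^*)$, and let $d(X)$ (the zero-dilation index) be the largest integer $k\ge 0$ such that $X$ is unitarily similar to a block matrix $\begin{bmatrix}0_k&*\\ *&*\end{bmatrix}$, where $0_k$ is the $k\times k$ zero matrix. For a Hermitian matrix $H$, let $i_{\ge 0}(H)$ be the number of nonnegative eigenvalues of $H$, counted with multiplicity. Let $J_k(0)$ be the $k\times k$ upper triangular nilpotent Jordan block, $I_k$ the $k\times k$ identity matrix, $\oplus$ the direct sum and $\otimes$ the Kronecker product $[x_{ij}]\otimes Y=[x_{ij}Y]$. Then $$d(\mathcal K_m(A))=i_{\ge 0}\big(\mathrm{Re}(\mathcal K_m(A))\big)=i_{\ge 0}\big(2\,\mathrm{Re}(J_m(0)\otimes A)-2\,(I_{m-1}\oplus[0])\otimes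 AA^*\big).$$ If moreover $A$ is nonsingular, then $$d(\mathcal K_m(A))=n+i_{\ge 0}\big(2\,\mathrm{Re}(J_{m-2}(0)\otimes A)-2\,(I_{m-2}\otimes AA^*)\big).$$ -/

import Mathlib

open scoped Matrix Kronecker

namespace ZeroDilation

/-- Two square complex matrices (with possibly different finite index types, necessarily of the
same size) are unitarily similar: `B = U* A U` for some unitary `U`. -/
def UnitarilySimilar {ι κ : Type*} [Fintype ι] [DecidableEq ι] [Fintype κ] [DecidableEq κ]
    (A : Matrix ι ι ℂ) (B : Matrix κ κ ℂ) : Prop :=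
  ∃ U : Matrix ι κ ℂ, Uᴴ * U = 1 ∧ U * Uᴴ = 1 ∧ B = Uᴴ * A * U

/-- The matrix `B` dilates to `A`: `A` is unitarily similar to a block matrix
`[B, *; *, *]`. (The complementary block may be empty.) -/
def Dilates {ι κ : Type*} [Fintype ι] [DecidableEq ι] [Fintype κ] [DecidableEq κ]
    (B : Matrix κ κ ℂ) (A : Matrix ι ι ℂ) : Prop :=
  ∃ (r : ℕ) (X : Matrix κ (Fin r) ℂ) (Y : Matrix (Fin r) κ ℂ) (Z : Matrix (Fin r) (Fin r) ℂ),
    UnitarilySimilar A (Matrix.fromBlocks B X Y Z)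

/-- The zero-dilation index `d(A)`: the largest `k` such that the `k`-by-`k` zero matrix dilates
to `A` (see `isGreatest_zeroDilationIndex`: the maximum is attained). -/
noncomputable def zeroDilationIndex {ι : Type*} [Fintype ι] [DecidableEq ι]
    (A : Matrix ι ι ℂ) : ℕ :=
  sSup {k : ℕ | Dilates (0 : Matrix (Fin k) (Fin k) ℂ) A}

/-- The number `i₊(H)` of positive eigenvalues of `H`, counted with multiplicity. -/
noncomputable def iPos {ι : Type*} [Fintype ι] [DecidableEq ι] (H : Matrix ι ι ℂ) : ℕ :=
  H.charpoly.roots.countP (fun z => z.im = 0 ∧ 0 < z.re)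

/-- The number `i₀(H)` of zero eigenvalues of `H`, counted with multiplicity. -/
noncomputable def iZero {ι : Type*} [Fintype ι] [DecidableEq ι] (H : Matrix ι ι ℂ) : ℕ :=
  H.charpoly.roots.count 0

/-- The number `i_{≥0}(H)` of nonnegative eigenvalues of `H`, counted with multiplicity. -/
noncomputable def iNonneg {ι : Type*} [Fintype ι] [DecidableEq ι] (H : Matrix ι ι ℂ) : ℕ :=
  iPos H + iZero H

/-- The Hermitian part `Re X = (X + X*) / 2`. -/
noncomputable def hermPart {ι : Type*} (X : Matrix ι ι ℂ) : Matrix ι ι ℂ :=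
  (1 / 2 : ℂ) • (X + Xᴴ)

/-- The upper triangular `k`-by-`k` Jordan block `J_k(c)`. -/
def jordanBlock (k : ℕ) (c : ℂ) : Matrix (Fin k) (Fin k) ℂ :=
  Matrix.of fun i j => if i = j then c else if (i : ℕ) + 1 = (j : ℕ) then 1 else 0

/-- The `m`-by-`m` matrix `I_{m-1} ⊕ [0]` (for `m ≥ 1`). -/
def idDirectSumZero (m : ℕ) : Matrix (Fin m) (Fin m) ℂ :=
  Matrix.diagonal fun i => if (i : ℕ) + 1 < m then 1 else 0

/-- The block upper triangular KMS matrix `K_m(A)`: its block in position `(i, j)` is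
`A ^ (j - i)` if `i < j`, and zero otherwise. -/
def kms (m : ℕ) {n : ℕ} (A : Matrix (Fin n) (Fin n) ℂ) :
    Matrix (Fin m × Fin n) (Fin m × Fin n) ℂ :=
  Matrix.of fun p q =>
    if p.1 < q.1 then (A ^ ((q.1 : ℕ) - (p.1 : ℕ))) p.2 q.2 else 0

/-- The set defining the zero-dilation index has a maximum, which is the index. -/
theorem isGreatest_zeroDilationIndex {ι : Type*} [Fintype ι] [DecidableEq ι]
    (A : Matrix ι ι ℂ) :
    IsGreatest {k : ℕ | Dilates (0 : Matrix (Fin k) (Fin k) ℂ) A} (zeroDilationIndex A) := by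
  have hb : BddAbove {k : ℕ | Dilates (0 : Matrix (Fin k) (Fin k) ℂ) A} := by
    refine ⟨Fintype.card ι, ?_⟩
    rintro k ⟨r, X, Y, Z, U, h1, h2, -⟩
    have h := Matrix.square_of_invertible U Uᴴ h2 h1
    simp only [Fintype.card_sum, Fintype.card_fin] at h
    omega
  have hne : {k : ℕ | Dilates (0 : Matrix (Fin k) (Fin k) ℂ) A}.Nonempty := by
    let e : ι ≃ Fin 0 ⊕ Fin (Fintype.card ι) :=
      (Fintype.equivFin ι).trans (Equiv.emptySum (Fin 0) (Fin (Fintype.card ι))).symm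
    let M := A.submatrix e.symm e.symm
    refine ⟨0, Fintype.card ι, M.toBlocks₁₂, M.toBlocks₂₁, M.toBlocks₂₂,
      (1 : Matrix ι ι ℂ).submatrix id e.symm, ?_, ?_, ?_⟩
    · rw [Matrix.conjTranspose_submatrix, Matrix.conjTranspose_one]
      ext i j
      simp [Matrix.mul_apply, Matrix.one_apply]
    · rw [Matrix.conjTranspose_submatrix, Matrix.conjTranspose_one,
        Matrix.submatrix_mul_equiv]
      simp
    · rw [Matrix.conjTranspose_submatrix, Matrix.conjTranspose_one]
      have h0 : (0 : Matrix (Fin 0) (Fin 0) ℂ) = M.toBlocks₁₁ := Subsingleton.elim _ _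
      rw [h0, Matrix.fromBlocks_toBlocks]
      ext i j
      simp [M, Matrix.mul_apply, Matrix.one_apply]
  exact ⟨Nat.sSup_mem hne hb, fun k hk => le_csSup hb hk⟩

/-- For a Hermitian matrix, `iNonneg` is the number of indices with nonnegative eigenvalue. -/
theorem iNonneg_eq_card {ι : Type*} [Fintype ι] [DecidableEq ι] {H : Matrix ι ι ℂ}
    (hH : H.IsHermitian) :
    iNonneg H = (Finset.univ.filter fun i => 0 ≤ hH.eigenvalues i).card := by
  have h := hH.roots_charpoly_eq_eigenvalues
  unfold iNonneg iPos iZero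
  rw [h, Multiset.countP_map, Multiset.count_map]
  have e : (Finset.univ.filter fun i => 0 ≤ hH.eigenvalues i)
      = (Finset.univ.filter fun i => 0 < hH.eigenvalues i) ∪
        (Finset.univ.filter fun i => 0 = hH.eigenvalues i) := by
    ext i
    simp [le_iff_lt_or_eq]
  rw [e, Finset.card_union_of_disjoint]
  · simp only [Finset.card_def, Finset.filter_val]
    congr 3
    · ext i; simp
    · ext i
      simp only [Function.comp_apply]
      exact eq_comm.trans (Complex.ofReal_eq_zero.trans eq_comm)
  · rw [Finset.disjoint_filter]
    intro i _ h1 h2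
    exact h1.ne h2

end ZeroDilation

open scoped InnerProductSpace

namespace ZeroDilation

/-! ### Root subspaces of a Hermitian pencil. -/

section Pencil

variable {F : Type*} [NormedAddCommGroup F] [InnerProductSpace ℂ F]

/-! The index `d(X)` is the largest dimension of a subspace on which the form `⟪x, X y⟫` vanishes,
so it is at most the index of `Re X`; the content is the reverse inequality for `kms`. Put `N = J ⊗
A`. The KMS matrix is the sum of the powers `N ^ k`, `k ≥ 1`, so `1 + K = (1 - N)⁻¹` and `K` is
congruent by `1 - N` to `N - N N*`. Congruence preserves both isotropic dimensions and inertia, so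
it remains to find an isotropic subspace for `N - N N*` as large as a nonnegative subspace of `Re N
- N N*`. The block grading `D` satisfies `[D, N] = N`, while `Q = N N*` has degree zero. If `Q` is
definite and `t > 0`, a virial identity makes `Re N - t Q` negative on real eigenvectors of the
pencil it forms with `Im N` (`re_inner_neg_of_graded_pencil`). The root subspaces in the upper half
plane then span a common isotropic subspace of the right dimension (`exists_isotropic_of_pencil`);
letting `t → 1` gives the claim (`exists_orthonormal_isotropic_of_graded`). The kernel of `N*`,
where `Q` degenerates, is split off in `exists_isotropic_of_graded`. For `A` invertible, the last
block is isotropic for the reduced form; a maximal nonnegative subspace may be taken orthogonal to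
it for the form, which kills the last but one component, and the last block then contributes `n`
zeros. -/

theorem inner_sub_smul_pow_left {H A : Module.End ℂ F} (hA : ∀ x y, ⟪A x, H y⟫_ℂ = ⟪x, H (A y)⟫_ℂ)
    (c : ℂ) (k : ℕ) (x y : F) :
    ⟪((A - c • (1 : Module.End ℂ F)) ^ k) x, H y⟫_ℂ
      = ⟪x, H (((A - (starRingEnd ℂ c) • (1 : Module.End ℂ F)) ^ k) y)⟫_ℂ := by
  induction k generalizing x y with
  | zero => simp
  | succ k ih =>
    rw [pow_succ', pow_succ]
    simp only [Module.End.mul_apply]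
    rw [← ih]
    simp [hA, mul_comm]

/-- Root subspaces of an operator which is self-adjoint for a Hermitian form are orthogonal for
the form, unless the eigenvalues are conjugate to each other. -/
theorem inner_eq_zero_of_mem_maxGenEigenspace {H A : Module.End ℂ F}
    (hA : ∀ x y, ⟪A x, H y⟫_ℂ = ⟪x, H (A y)⟫_ℂ) {a b : ℂ} (hab : starRingEnd ℂ a ≠ b) {x y : F}
    (hx : x ∈ A.maxGenEigenspace a) (hy : y ∈ A.maxGenEigenspace b) : ⟪x, H y⟫_ℂ = 0 := by
  rw [Module.End.mem_maxGenEigenspace] at hx hy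
  obtain ⟨k, hk⟩ := hx
  obtain ⟨l, hl⟩ := hy
  -- By Bézout, `y = (A - conj a)^k u(A) y`, since `(A - b)^l` kills `y`; moved to the other side of
  -- the form, the power becomes `(A - a)^k`, which kills `x`.
  have hcop : IsCoprime ((Polynomial.X - Polynomial.C (starRingEnd ℂ a)) ^ k)
      ((Polynomial.X - Polynomial.C b) ^ l) :=
    (Polynomial.isCoprime_X_sub_C_of_isUnit_sub (sub_ne_zero.2 hab).isUnit).pow
  obtain ⟨u, v, huv⟩ := hcop
  have h1 := congrArg (fun p => Polynomial.aeval A p y) huv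
  have haev : ∀ (c : ℂ) (j : ℕ), Polynomial.aeval A ((Polynomial.X - Polynomial.C c) ^ j)
      = (A - c • (1 : Module.End ℂ F)) ^ j := by
    intro c j
    simp [Algebra.algebraMap_eq_smul_one]
  rw [mul_comm u] at h1
  simp only [map_add, map_mul, haev, LinearMap.add_apply, Module.End.mul_apply, hl, map_zero,
    add_zero, map_one, Module.End.one_apply] at h1
  rw [← h1, ← inner_sub_smul_pow_left hA, hk, inner_zero_left]

/-- The end `z = (A - a) x` of a Jordan chain of length two would satisfy `⟪z, H z⟫ = ⟪x, H (A - a)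
z⟫ = 0`, against the negativity on eigenvectors. -/
theorem maxGenEigenspace_le_eigenspace {H A : Module.End ℂ F}
    (hA : ∀ x y, ⟪A x, H y⟫_ℂ = ⟪x, H (A y)⟫_ℂ) {a : ℂ} (ha : starRingEnd ℂ a = a)
    (hneg : ∀ x, x ≠ 0 → A x = a • x → (⟪x, H x⟫_ℂ).re < 0) :
    A.maxGenEigenspace a ≤ A.eigenspace a := by
  intro x hx
  rw [Module.End.mem_maxGenEigenspace] at hx
  obtain ⟨k, hk⟩ := hx
  have hsub : ∀ z, (A - a • (1 : Module.End ℂ F)) z = 0 ↔ A z = a • z := by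
    intro z; simp [sub_eq_zero]
  rw [Module.End.mem_eigenspace_iff, ← hsub]
  induction k generalizing x with
  | zero => simp at hk; simp [hk]
  | succ k ih =>
    rw [pow_succ, Module.End.mul_apply] at hk
    have h2 := ih hk
    by_contra h0
    have h3 := hneg _ h0 ((hsub _).1 h2)
    have h4 := inner_sub_smul_pow_left hA a 1 x ((A - a • (1 : Module.End ℂ F)) x)
    rw [pow_one, ha, pow_one, h2, map_zero, inner_zero_right] at h4
    rw [h4] at h3
    simp at h3

/-- Let `H`, `G` be Hermitian forms, `H` nondegenerate and negative on the real eigenvectors of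
the pencil. Then there is a common isotropic subspace whose dimension is the positive index of
`H`. -/
theorem exists_isotropic_of_pencil [FiniteDimensional ℂ F] {H G : Module.End ℂ F}
    (hH : H.IsSymmetric) (hG : G.IsSymmetric) (hinj : Function.Injective H)
    (hneg : ∀ (a : ℝ) (x : F), x ≠ 0 → G x = (a : ℂ) • H x → (⟪x, H x⟫_ℂ).re < 0)
    (M : Submodule ℂ F) (hM : ∀ x ∈ M, x ≠ 0 → 0 < (⟪x, H x⟫_ℂ).re) :
    ∃ L : Submodule ℂ F, Module.finrank ℂ M ≤ Module.finrank ℂ L ∧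
      ∀ x ∈ L, ∀ y ∈ L, ⟪x, H y⟫_ℂ = 0 ∧ ⟪x, G y⟫_ℂ = 0 := by
  let e := LinearEquiv.ofInjectiveEndo H hinj
  let A : Module.End ℂ F := e.symm.toLinearMap ∘ₗ G
  have hHA : ∀ x, H (A x) = G x := fun x => e.apply_symm_apply (G x)
  have hA : ∀ x y, ⟪A x, H y⟫_ℂ = ⟪x, H (A y)⟫_ℂ := by
    intro x y
    rw [← hH, hHA, hHA, hG]
  -- With `A = H⁻¹ G`, the sum of the root subspaces for eigenvalues in `s`. The upper half plane
  -- will give the isotropic space, its complement a nonpositive one.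
  let S : Set ℂ → Submodule ℂ F := fun s => ⨆ a : s, A.maxGenEigenspace (a : ℂ)
  have hgen : ∀ a ∈ {z : ℂ | z.im ≤ 0}, ∀ x ∈ A.maxGenEigenspace a, ∀ b ∈ {z : ℂ | z.im ≤ 0},
      ∀ y ∈ A.maxGenEigenspace b, a ≠ b → ⟪x, H y⟫_ℂ = 0 := by
    intro a ha x hx b hb y hy hab
    refine inner_eq_zero_of_mem_maxGenEigenspace hA ?_ hx hy
    rintro rfl
    simp only [Set.mem_ofPred_eq, Complex.conj_im] at ha hb
    exact hab (Complex.conj_eq_iff_im.2 (by linarith)).symm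
  have hdiag : ∀ a ∈ {z : ℂ | z.im ≤ 0}, ∀ x ∈ A.maxGenEigenspace a, (⟪x, H x⟫_ℂ).re ≤ 0 := by
    intro a ha x hx
    by_cases hc : starRingEnd ℂ a = a
    · have hneg' : ∀ x, x ≠ 0 → A x = a • x → (⟪x, H x⟫_ℂ).re < 0 := by
        intro x hx0 hAx
        refine hneg a.re x hx0 ?_
        rw [← hHA, hAx, map_smul, Complex.conj_eq_iff_re.1 hc]
      have hxe := maxGenEigenspace_le_eigenspace hA hc hneg' hx
      rw [Module.End.mem_eigenspace_iff] at hxe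
      by_cases hx0 : x = 0
      · simp [hx0]
      · exact (hneg' x hx0 hxe).le
    · rw [inner_eq_zero_of_mem_maxGenEigenspace hA hc hx hx]
      simp
  have hnonpos : ∀ x ∈ S {z | z.im ≤ 0}, (⟪x, H x⟫_ℂ).re ≤ 0 := by
    intro x hx
    obtain ⟨f, hf, rfl⟩ := (Submodule.mem_iSup_iff_exists_finsupp _ _).1 hx
    simp only [Finsupp.sum, map_sum, sum_inner, inner_sum, Complex.re_sum]
    refine Finset.sum_nonpos fun i _ => Finset.sum_nonpos fun j _ => ?_
    by_cases hij : i = j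
    · subst hij
      exact hdiag i i.2 _ (hf i)
    · rw [hgen j j.2 _ (hf j) i i.2 _ (hf i) (fun h => hij (Subtype.ext h.symm))]
      simp
  have hiso : ∀ x ∈ S {z | 0 < z.im}, ∀ y ∈ S {z | 0 < z.im}, ⟪x, H y⟫_ℂ = 0 := by
    intro x hx y hy
    obtain ⟨f, hf, rfl⟩ := (Submodule.mem_iSup_iff_exists_finsupp _ _).1 hx
    obtain ⟨g, hg, rfl⟩ := (Submodule.mem_iSup_iff_exists_finsupp _ _).1 hy
    simp only [Finsupp.sum, map_sum, sum_inner, inner_sum]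
    refine Finset.sum_eq_zero fun i _ => Finset.sum_eq_zero fun j _ => ?_
    refine inner_eq_zero_of_mem_maxGenEigenspace hA ?_ (hf _) (hg _)
    intro h
    have h1 := i.2
    have h2 := j.2
    simp only [Set.mem_ofPred_eq] at h1 h2
    have h3 := congrArg Complex.im h
    simp only [Complex.conj_im] at h3
    linarith
  have hinv : ∀ x ∈ S {z | 0 < z.im}, A x ∈ S {z | 0 < z.im} := by
    intro x hx
    have : S {z | 0 < z.im} ≤ (S {z | 0 < z.im}).comap A := by
      refine iSup_le fun a y hy => ?_
      exact Submodule.mem_iSup_of_mem a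
        (A.mapsTo_maxGenEigenspace_of_comm (Commute.refl A) _ hy)
    exact this hx
  have htop : S {z | 0 < z.im} ⊔ S {z | z.im ≤ 0} = ⊤ := by
    rw [eq_top_iff, ← Module.End.iSup_maxGenEigenspace_eq_top A]
    refine iSup_le fun a => ?_
    rcases lt_or_ge 0 a.im with h | h
    · exact (le_iSup (fun b : {z : ℂ | 0 < z.im} => A.maxGenEigenspace (b : ℂ)) ⟨a, h⟩).trans
        le_sup_left
    · exact (le_iSup (fun b : {z : ℂ | z.im ≤ 0} => A.maxGenEigenspace (b : ℂ)) ⟨a, h⟩).trans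
        le_sup_right
  -- `M` meets the nonpositive space trivially, which bounds its dimension by that of the upper half
  -- plane part. Isotropy for `G = H A` follows from invariance under `A`.
  refine ⟨S {z | 0 < z.im}, ?_, fun x hx y hy => ⟨hiso x hx y hy, ?_⟩⟩
  · have h1 := Submodule.finrank_sup_add_finrank_inf_eq (S {z | 0 < z.im}) (S {z | z.im ≤ 0})
    rw [htop, finrank_top] at h1
    have hbot : M ⊓ S {z | z.im ≤ 0} = ⊥ := by
      rw [eq_bot_iff]
      rintro x ⟨hxM, hxS⟩
      by_contra hx0
      exact absurd (hM x hxM hx0) (not_lt.2 (hnonpos x hxS))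
    have h2 := Submodule.finrank_sup_add_finrank_inf_eq M (S {z | z.im ≤ 0})
    rw [hbot, finrank_bot] at h2
    have h3 := Submodule.finrank_le (M ⊔ S {z | z.im ≤ 0})
    omega
  · rw [← hHA]
    exact hiso x hx _ (hinv y hy)

end Pencil

/-! ### Graded operators with a definite degree-zero term. -/

section Graded

variable {F : Type*} [NormedAddCommGroup F] [InnerProductSpace ℂ F] [FiniteDimensional ℂ F]

/-- The Hermitian part of an operator. -/
noncomputable def reEnd (N : Module.End ℂ F) : Module.End ℂ F :=
  (1 / 2 : ℂ) • (N + LinearMap.adjoint N)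

/-- The skew part of an operator, divided by the imaginary unit. -/
noncomputable def imEnd (N : Module.End ℂ F) : Module.End ℂ F :=
  (-Complex.I / 2 : ℂ) • (N - LinearMap.adjoint N)

theorem inner_reEnd (N : Module.End ℂ F) (x y : F) :
    ⟪x, reEnd N y⟫_ℂ = (1 / 2) * (⟪x, N y⟫_ℂ + ⟪N x, y⟫_ℂ) := by
  simp [reEnd, LinearMap.adjoint_inner_right, mul_add]

theorem inner_imEnd (N : Module.End ℂ F) (x y : F) :
    ⟪x, imEnd N y⟫_ℂ = (-Complex.I / 2) * (⟪x, N y⟫_ℂ - ⟪N x, y⟫_ℂ) := by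
  simp [imEnd, LinearMap.adjoint_inner_right]

theorem isSymmetric_reEnd (N : Module.End ℂ F) : (reEnd N).IsSymmetric := by
  intro x y
  rw [← inner_conj_symm, inner_reEnd, inner_reEnd]
  simp only [map_mul, map_div₀, map_one, map_add, inner_conj_symm, map_ofNat]
  ring

theorem isSymmetric_imEnd (N : Module.End ℂ F) : (imEnd N).IsSymmetric := by
  intro x y
  rw [← inner_conj_symm, inner_imEnd, inner_imEnd]
  simp only [map_mul, map_div₀, map_neg, map_sub, Complex.conj_I, inner_conj_symm, map_ofNat]
  ring

theorem re_inner_reEnd_self (N : Module.End ℂ F) (x : F) :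
    (⟪x, reEnd N x⟫_ℂ).re = (⟪x, N x⟫_ℂ).re := by
  have h : (⟪N x, x⟫_ℂ).re = (⟪x, N x⟫_ℂ).re := by
    rw [← inner_conj_symm]; exact Complex.conj_re _
  rw [inner_reEnd]
  simp [h]
  ring

theorem inner_reEnd_add_imEnd (N : Module.End ℂ F) (x y : F) :
    ⟪x, N y⟫_ℂ = ⟪x, reEnd N y⟫_ℂ + Complex.I * ⟪x, imEnd N y⟫_ℂ := by
  rw [inner_reEnd, inner_imEnd]
  linear_combination (1 / 2 * (⟪x, N y⟫_ℂ - ⟪N x, y⟫_ℂ)) * Complex.I_mul_I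

/-- A virial argument: `[D, Re N] = i Im N` and `[D, Im N] = -i Re N` as forms, and `Q` commutes
with `D`. Evaluating the commutator with `D` on an eigenvector gives `⟨Re N⟩ = -a ⟨Im N⟩ = -a² ⟨H⟩`
for `H = Re N - t Q`, hence `(1 + a²) ⟨H⟩ = -t ⟨Q⟩ < 0`. -/
theorem re_inner_neg_of_graded_pencil {N Q D : Module.End ℂ F}
    (hN : ∀ x y, ⟪D x, N y⟫_ℂ - ⟪x, N (D y)⟫_ℂ = ⟪x, N y⟫_ℂ) (hQs : Q.IsSymmetric)
    (hDQ : ∀ x y, ⟪D x, Q y⟫_ℂ = ⟪x, Q (D y)⟫_ℂ)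
    {t : ℝ} (ht : 0 < t) {a : ℝ} {x : F} (hx : 0 < (⟪x, Q x⟫_ℂ).re)
    (h : imEnd N x = (a : ℂ) • (reEnd N - (t : ℂ) • Q) x) :
    (⟪x, (reEnd N - (t : ℂ) • Q) x⟫_ℂ).re < 0 := by
  have hHs : (reEnd N - (t : ℂ) • Q).IsSymmetric := by
    intro u v
    simp only [LinearMap.sub_apply, LinearMap.smul_apply, inner_sub_left, inner_sub_right,
      inner_smul_left, inner_smul_right, isSymmetric_reEnd N u v, hQs u v, Complex.conj_ofReal]
  have h1 : ⟪D x, imEnd N x⟫_ℂ = a * ⟪D x, (reEnd N - (t : ℂ) • Q) x⟫_ℂ := by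
    rw [h, inner_smul_right]
  have h2 : ⟪x, imEnd N (D x)⟫_ℂ = a * ⟪x, (reEnd N - (t : ℂ) • Q) (D x)⟫_ℂ := by
    rw [← isSymmetric_imEnd, ← hHs, h, inner_smul_left, Complex.conj_ofReal]
  have h3 : ⟪x, imEnd N x⟫_ℂ = a * ⟪x, (reEnd N - (t : ℂ) • Q) x⟫_ℂ := by
    rw [h, inner_smul_right]
  have hc := hN x x
  have hc' := congrArg (starRingEnd ℂ) hc
  simp only [map_sub, inner_conj_symm] at hc'
  have hq := hDQ x x
  simp only [LinearMap.sub_apply, LinearMap.smul_apply, inner_sub_right, inner_smul_right,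
    inner_reEnd, inner_imEnd] at h1 h2 h3 ⊢
  have key : (-Complex.I / 2) * (⟪x, N x⟫_ℂ + ⟪N x, x⟫_ℂ)
      = a * ((1 / 2) * (⟪x, N x⟫_ℂ - ⟪N x, x⟫_ℂ)) := by
    linear_combination h1 - h2 - (-Complex.I / 2 - a / 2) * hc - (-Complex.I / 2 + a / 2) * hc'
      - a * t * hq
  rw [← inner_conj_symm (N x) x] at key h3 ⊢
  have hqr : (⟪x, Q x⟫_ℂ).im = 0 := by
    have := hQs x x
    rw [← inner_conj_symm] at this
    exact Complex.conj_eq_iff_im.1 this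
  generalize ⟪x, N x⟫_ℂ = n at *
  generalize ⟪x, Q x⟫_ℂ = q at *
  have k1 := congrArg Complex.im key
  have k2 := congrArg Complex.re h3
  simp at k1 k2 ⊢
  have e3 : n.re = -(a ^ 2 * (n.re - t * q.re)) := by linear_combination -k1 - a * k2
  by_contra! hcon
  nlinarith [mul_nonneg (sq_nonneg a) (show 0 ≤ n.re - t * q.re by linarith), mul_pos ht hx]

theorem exists_orthonormal_of_le_finrank {k : ℕ} {L : Submodule ℂ F}
    (hk : k ≤ Module.finrank ℂ L) :
    ∃ e : Fin k → F, Orthonormal ℂ e ∧ ∀ i, e i ∈ L := by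
  let b := stdOrthonormalBasis ℂ L
  refine ⟨fun i => (b (Fin.castLE hk i) : F), ?_, fun i => (b _).2⟩
  exact (b.orthonormal.comp _ (Fin.castLE_injective hk)).comp_linearIsometry L.subtypeₗᵢ

/-- Orthonormal `k`-frames form a compact set and the isotropy equations are closed, so isotropic
frames survive the limit. -/
theorem exists_orthonormal_isotropic_of_tendsto {N Q : Module.End ℂ F} {k : ℕ} {T : Set ℝ}
    (hT : ∀ t ∈ T, ∃ e : Fin k → F, Orthonormal ℂ e ∧
      ∀ i j, ⟪e i, N (e j) - (t : ℂ) • Q (e j)⟫_ℂ = 0) {s : ℝ} (hs : s ∈ closure T) :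
    ∃ e : Fin k → F, Orthonormal ℂ e ∧ ∀ i j, ⟪e i, N (e j) - (s : ℂ) • Q (e j)⟫_ℂ = 0 := by
  have hNc : Continuous N := N.continuous_of_finiteDimensional
  have hQc : Continuous Q := Q.continuous_of_finiteDimensional
  obtain ⟨u, huT, hu⟩ := mem_closure_iff_seq_limit.1 hs
  choose e heo hei using fun n => hT (u n) (huT n)
  have hcomp : IsCompact (Metric.closedBall (0 : Fin k → F) 1) := isCompact_closedBall 0 1
  have hmem : ∀ n, e n ∈ Metric.closedBall (0 : Fin k → F) 1 := by
    intro n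
    rw [mem_closedBall_zero_iff, pi_norm_le_iff_of_nonneg zero_le_one]
    exact fun i => ((heo n).1 i).le
  obtain ⟨f, -, φ, hφ, hf⟩ := hcomp.tendsto_subseq hmem
  have hfi : ∀ i, Filter.Tendsto (fun n => e (φ n) i) Filter.atTop (nhds (f i)) := fun i =>
    (continuous_apply i).continuousAt.tendsto.comp hf
  have huφ : Filter.Tendsto (fun n => ((u (φ n) : ℝ) : ℂ)) Filter.atTop (nhds (s : ℂ)) :=
    (Complex.continuous_ofReal.tendsto s).comp (hu.comp hφ.tendsto_atTop)
  refine ⟨f, ?_, fun i j => ?_⟩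
  · rw [orthonormal_iff_ite]
    intro i j
    refine tendsto_nhds_unique ((hfi i).inner (hfi j)) ?_
    simp only [orthonormal_iff_ite.1 (heo _) i j]
    exact tendsto_const_nhds
  · refine tendsto_nhds_unique ((hfi i).inner (((hNc.tendsto _).comp (hfi j)).sub
      (huφ.smul ((hQc.tendsto _).comp (hfi j))))) ?_
    simp only [Function.comp_apply, hei]
    exact tendsto_const_nhds

/-- Let `N` be homogeneous of degree one for the grading given by `D`, and let `Q` be positive
definite and of degree zero. If `Re N - Q` is nonnegative on `M`, then `N - Q` has an isotropic
subspace of the same dimension as `M`. -/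
theorem exists_orthonormal_isotropic_of_graded {N Q D : Module.End ℂ F}
    (hN : ∀ x y, ⟪D x, N y⟫_ℂ - ⟪x, N (D y)⟫_ℂ = ⟪x, N y⟫_ℂ) (hQs : Q.IsSymmetric)
    (hDQ : ∀ x y, ⟪D x, Q y⟫_ℂ = ⟪x, Q (D y)⟫_ℂ) (hQ : ∀ x, x ≠ 0 → 0 < (⟪x, Q x⟫_ℂ).re)
    {M : Submodule ℂ F} (hM : ∀ x ∈ M, (⟪x, Q x⟫_ℂ).re ≤ (⟪x, N x⟫_ℂ).re) :
    ∃ e : Fin (Module.finrank ℂ M) → F, Orthonormal ℂ e ∧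
      ∀ i j, ⟪e i, N (e j) - Q (e j)⟫_ℂ = 0 := by
  have hQinj : Function.Injective Q := by
    rw [injective_iff_map_eq_zero]
    intro x hx
    by_contra h0
    have := hQ x h0
    simp [hx] at this
  let e := LinearEquiv.ofInjectiveEndo Q hQinj
  let B : Module.End ℂ F := e.symm.toLinearMap ∘ₗ reEnd N
  -- The values of `t` at which `Re N - t Q` is singular are eigenvalues of `Q⁻¹ Re N`, so finitely
  -- many; the others accumulate at `1` from below.
  let bad : Set ℝ := {t : ℝ | B.HasEigenvalue (t : ℂ)}
  have hbad : bad.Finite :=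
    (Module.End.finite_hasEigenvalue B).preimage Complex.ofReal_injective.injOn
  let T : Set ℝ := Set.Ioo 0 1 \ bad
  have hcl : (1 : ℝ) ∈ closure T := by
    have h1 : (1 : ℝ) ∈ closure (Set.Ioo (0 : ℝ) 1) := by
      rw [closure_Ioo (by norm_num)]; simp
    have h2 : Dense badᶜ := hbad.countable.dense_compl ℝ
    have h3 := h2.open_subset_closure_inter (isOpen_Ioo (a := (0 : ℝ)) (b := 1))
    have h4 := closure_minimal h3 isClosed_closure
    exact h4 h1
  have hT : ∀ t ∈ T, ∃ e : Fin (Module.finrank ℂ M) → F, Orthonormal ℂ e ∧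
      ∀ i j, ⟪e i, N (e j) - (t : ℂ) • Q (e j)⟫_ℂ = 0 := by
    rintro t ⟨⟨ht0, ht1⟩, htb⟩
    have hHs : (reEnd N - (t : ℂ) • Q).IsSymmetric := by
      intro u v
      simp only [LinearMap.sub_apply, LinearMap.smul_apply, inner_sub_left, inner_sub_right,
        inner_smul_left, inner_smul_right, isSymmetric_reEnd N u v, hQs u v, Complex.conj_ofReal]
    have hinj : Function.Injective (reEnd N - (t : ℂ) • Q) := by
      rw [injective_iff_map_eq_zero]
      intro x hx
      by_contra h0
      refine htb (Module.End.hasEigenvalue_of_hasEigenvector (x := x)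
        ((Module.End.hasEigenvector_iff).2 ⟨Module.End.mem_eigenspace_iff.2 ?_, h0⟩))
      rw [LinearMap.sub_apply, sub_eq_zero] at hx
      change e.symm (reEnd N x) = _
      rw [hx, LinearEquiv.symm_apply_eq, map_smul]
      rfl
    have hre : ∀ x, (⟪x, (reEnd N - (t : ℂ) • Q) x⟫_ℂ).re
        = (⟪x, N x⟫_ℂ).re - t * (⟪x, Q x⟫_ℂ).re := by
      intro x
      rw [← re_inner_reEnd_self N, LinearMap.sub_apply, LinearMap.smul_apply, inner_sub_right,
        inner_smul_right, Complex.sub_re, Complex.re_ofReal_mul]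
    obtain ⟨L, hL, hiso⟩ := exists_isotropic_of_pencil hHs (isSymmetric_imEnd N) hinj
      (fun a x hx h => re_inner_neg_of_graded_pencil hN hQs hDQ ht0 (hQ x hx) h) M
      -- `Re N - t Q` is `(Re N - Q) + (1 - t) Q`, strictly positive on `M` because `t < 1`.
      (fun x hxM hx => by
        rw [hre]
        have h1 := hM x hxM
        have h2 := hQ x hx
        nlinarith)
    obtain ⟨f, hfo, hfL⟩ := exists_orthonormal_of_le_finrank hL
    refine ⟨f, hfo, fun i j => ?_⟩
    obtain ⟨h1, h2⟩ := hiso _ (hfL i) _ (hfL j)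
    rw [LinearMap.sub_apply, LinearMap.smul_apply, inner_sub_right] at h1
    rw [inner_sub_right, inner_reEnd_add_imEnd, h2, mul_zero, add_zero, h1]
  obtain ⟨f, hfo, hf⟩ := exists_orthonormal_isotropic_of_tendsto hT hcl
  exact ⟨f, hfo, fun i j => by simpa using hf i j⟩

end Graded

/-! ### Splitting off the kernel of `N*`. -/

section Reduction

variable {F : Type*} [NormedAddCommGroup F] [InnerProductSpace ℂ F]

/-- Cauchy–Schwarz for a semidefinite form: otherwise moving `x` along `v` would make the form
negative, as it is affine in the step. -/
theorem inner_eq_zero_of_nonneg {H : Module.End ℂ F} (hH : H.IsSymmetric) {M : Submodule ℂ F}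
    (hM : ∀ x ∈ M, 0 ≤ (⟪x, H x⟫_ℂ).re) {v x : F} (hv : v ∈ M) (hx : x ∈ M)
    (hvv : ⟪v, H v⟫_ℂ = 0) : ⟪v, H x⟫_ℂ = 0 := by
  by_contra hw
  set w := ⟪v, H x⟫_ℂ with hwdef
  have hxv : ⟪x, H v⟫_ℂ = starRingEnd ℂ w := by
    rw [hwdef, inner_conj_symm, hH]
  have hpos : 0 < Complex.normSq w := Complex.normSq_pos.2 hw
  have key : ∀ s : ℝ, 0 ≤ (⟪x, H x⟫_ℂ).re - 2 * s * Complex.normSq w := by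
    intro s
    have h := hM (x + (-(s : ℂ) * w) • v) (M.add_mem hx (M.smul_mem _ hv))
    have h2 : ⟪x + (-(s : ℂ) * w) • v, H (x + (-(s : ℂ) * w) • v)⟫_ℂ
        = ⟪x, H x⟫_ℂ - ((2 * s * Complex.normSq w : ℝ) : ℂ) := by
      simp only [map_add, map_smul, inner_add_left, inner_add_right, inner_smul_left,
        inner_smul_right, hvv, hxv, ← hwdef, map_mul, map_neg, Complex.conj_ofReal]
      push_cast
      rw [Complex.normSq_eq_conj_mul_self]
      ring
    rw [h2, Complex.sub_re, Complex.ofReal_re] at h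
    exact h
  -- This step size makes the value `c - (c + 1) = -1`, with `c` the form at `x`.
  have h1 := key (((⟪x, H x⟫_ℂ).re + 1) / (2 * Complex.normSq w))
  field_simp at h1
  linarith

theorem finrank_le_finrank_inf_orthogonal_add [FiniteDimensional ℂ F] (A B : Submodule ℂ F) :
    Module.finrank ℂ A ≤ Module.finrank ℂ (A ⊓ Bᗮ : Submodule ℂ F) + Module.finrank ℂ B := by
  have h1 := Submodule.finrank_sup_add_finrank_inf_eq A Bᗮ
  have h2 := Submodule.finrank_add_finrank_orthogonal B
  have h3 := Submodule.finrank_le (A ⊔ Bᗮ)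
  omega

/-- A nonnegative subspace of a Hermitian form can be replaced by one which contains a given
isotropic subspace, without decreasing its dimension. -/
theorem exists_nonneg_of_isotropic_le [FiniteDimensional ℂ F] {H : Module.End ℂ F}
    (hH : H.IsSymmetric) {V : Submodule ℂ F} (hV : ∀ v ∈ V, ∀ w ∈ V, ⟪v, H w⟫_ℂ = 0)
    {M : Submodule ℂ F} (hM : ∀ x ∈ M, 0 ≤ (⟪x, H x⟫_ℂ).re) :
    ∃ M' : Submodule ℂ F, Module.finrank ℂ M ≤ Module.finrank ℂ M' ∧ V ≤ M' ∧
      (∀ x ∈ M', ∀ v ∈ V, ⟪v, H x⟫_ℂ = 0) ∧ ∀ x ∈ M', 0 ≤ (⟪x, H x⟫_ℂ).re := by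
  -- `M ⊓ V` is already orthogonal to `M` for the form, so only its complement `K` in `V` imposes
  -- conditions. Passing from `M` to `U` loses at most `dim K`, and adding `V` regains at least
  -- that.
  let K : Submodule ℂ F := (M ⊓ V)ᗮ ⊓ V
  let U : Submodule ℂ F := M ⊓ (V.map H)ᗮ
  have hU : ∀ x ∈ U, ∀ v ∈ V, ⟪v, H x⟫_ℂ = 0 := by
    intro x hx v hv
    rw [← hH]
    exact (Submodule.mem_orthogonal _ _).1 hx.2 _ (Submodule.mem_map_of_mem hv)
  have hKV : Module.finrank ℂ (M ⊓ V : Submodule ℂ F) + Module.finrank ℂ K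
      = Module.finrank ℂ V := Submodule.finrank_add_inf_finrank_orthogonal (inf_le_right : M ⊓ V ≤ V)
  have hle : M ⊓ (K.map H)ᗮ ≤ U := by
    rintro x ⟨hxM, hxK⟩
    refine ⟨hxM, (Submodule.mem_orthogonal _ _).2 ?_⟩
    rintro _ ⟨v, hv, rfl⟩
    have hsup : (M ⊓ V) ⊔ K = V := Submodule.sup_orthogonal_inf_of_hasOrthogonalProjection
      (inf_le_right : M ⊓ V ≤ V)
    rw [← hsup] at hv
    obtain ⟨a, ha, b, hb, rfl⟩ := Submodule.mem_sup.1 hv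
    have h1 : ⟪H a, x⟫_ℂ = 0 := by
      rw [hH]
      exact inner_eq_zero_of_nonneg hH hM ha.1 hxM (hV _ ha.2 _ ha.2)
    have h2 : ⟪H b, x⟫_ℂ = 0 :=
      (Submodule.mem_orthogonal _ _).1 hxK _ (Submodule.mem_map_of_mem hb)
    rw [map_add, inner_add_left, h1, h2, add_zero]
  have hzero : ∀ x ∈ U ⊔ V, ∀ v ∈ V, ⟪v, H x⟫_ℂ = 0 := by
    intro x hx v hv
    obtain ⟨a, ha, b, hb, rfl⟩ := Submodule.mem_sup.1 hx
    rw [map_add, inner_add_right, hU a ha v hv, hV v hv b hb, add_zero]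
  refine ⟨U ⊔ V, ?_, le_sup_right, hzero, ?_⟩
  · have h1 := finrank_le_finrank_inf_orthogonal_add M (K.map H)
    have h2 := Submodule.finrank_map_le H K
    have h3 := Submodule.finrank_mono hle
    have h4 := Submodule.finrank_sup_add_finrank_inf_eq U V
    have h5 : Module.finrank ℂ (U ⊓ V : Submodule ℂ F) ≤ Module.finrank ℂ (M ⊓ V : Submodule ℂ F) :=
      Submodule.finrank_mono (inf_le_inf_right V (inf_le_left : U ≤ M))
    omega
  · intro x hx
    obtain ⟨a, ha, b, hb, rfl⟩ := Submodule.mem_sup.1 hx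
    have h1 := hzero _ hx b hb
    have h2 : ⟪a, H b⟫_ℂ = 0 := by
      rw [← hH, ← inner_conj_symm, hU a ha b hb, map_zero]
    rw [inner_add_left, h1, add_zero, map_add, inner_add_right, h2, add_zero]
    exact hM a ha.1

theorem inner_eq_zero_of_mem_span {κ : Type*} {B : Module.End ℂ F} {e : κ → F}
    (he : ∀ i j, ⟪e i, B (e j)⟫_ℂ = 0) {x y : F} (hx : x ∈ Submodule.span ℂ (Set.range e))
    (hy : y ∈ Submodule.span ℂ (Set.range e)) : ⟪x, B y⟫_ℂ = 0 := by
  induction hx, hy using Submodule.span_induction₂ with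
  | mem_mem x y hx hy =>
    obtain ⟨i, rfl⟩ := hx
    obtain ⟨j, rfl⟩ := hy
    exact he i j
  | zero_left => simp
  | zero_right => simp
  | add_left x y z _ _ _ h1 h2 => rw [inner_add_left, h1, h2, add_zero]
  | add_right x y z _ _ _ h1 h2 => rw [map_add, inner_add_right, h1, h2, add_zero]
  | smul_left r x y _ _ h => rw [inner_smul_left, h, mul_zero]
  | smul_right r x y _ _ h => rw [map_smul, inner_smul_right, h, mul_zero]

/-- If `N` is homogeneous of degree one for the grading given by `D` and `Re N - N N*` is
nonnegative on `M`, then `N - N N*` has an isotropic subspace of the same dimension as `M`. -/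
theorem exists_isotropic_of_graded [FiniteDimensional ℂ F] {N D : Module.End ℂ F}
    (hD : D.IsSymmetric) (hN : ∀ x, D (N x) - N (D x) = N x) {M : Submodule ℂ F}
    (hM : ∀ x ∈ M, (⟪LinearMap.adjoint N x, LinearMap.adjoint N x⟫_ℂ).re ≤ (⟪x, N x⟫_ℂ).re) :
    ∃ L : Submodule ℂ F, Module.finrank ℂ M ≤ Module.finrank ℂ L ∧
      ∀ x ∈ L, ∀ y ∈ L, ⟪x, N y - N (LinearMap.adjoint N y)⟫_ℂ = 0 := by
  set N' := LinearMap.adjoint N with hN'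
  have hadj : ∀ x y, ⟪N' x, y⟫_ℂ = ⟪x, N y⟫_ℂ := fun x y => LinearMap.adjoint_inner_left N y x
  have hadj' : ∀ x y, ⟪x, N' y⟫_ℂ = ⟪N x, y⟫_ℂ := fun x y => LinearMap.adjoint_inner_right N x y
  have hND' : ∀ x, N' (D x) = D (N' x) + N' x := by
    intro x
    refine ext_inner_right ℂ fun y => ?_
    rw [hadj, inner_add_left, hD, hD, hadj, hadj, ← inner_add_right]
    congr 1
    rw [← sub_eq_iff_eq_add', hN]
  let V : Submodule ℂ F := LinearMap.ker N'
  have hVmem : ∀ v, v ∈ V ↔ N' v = 0 := fun v => LinearMap.mem_ker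
  have hDV : ∀ v ∈ V, D v ∈ V := by
    intro v hv
    rw [hVmem] at hv ⊢
    rw [hND', hv, map_zero, add_zero]
  have hDVo : ∀ x ∈ Vᗮ, D x ∈ Vᗮ := by
    intro x hx
    rw [Submodule.mem_orthogonal] at hx ⊢
    intro v hv
    rw [← hD]
    exact hx _ (hDV v hv)
  let H : Module.End ℂ F := reEnd N - N ∘ₗ N'
  have hHs : H.IsSymmetric := by
    intro x y
    simp only [H, LinearMap.sub_apply, inner_sub_left, inner_sub_right, LinearMap.comp_apply,
      isSymmetric_reEnd N x y, ← hadj, ← hadj']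
  have hHre : ∀ x, (⟪x, H x⟫_ℂ).re = (⟪x, N x⟫_ℂ).re - (⟪N' x, N' x⟫_ℂ).re := by
    intro x
    simp only [H, LinearMap.sub_apply, inner_sub_right, LinearMap.comp_apply, Complex.sub_re,
      re_inner_reEnd_self, hadj]
  have hVH : ∀ v ∈ V, ∀ x, ⟪v, H x⟫_ℂ = (1 / 2) * ⟪v, N' x⟫_ℂ := by
    intro v hv x
    have h0 : ∀ z, ⟪v, N z⟫_ℂ = 0 := fun z => by
      rw [← hadj, (hVmem v).1 hv, inner_zero_left]
    simp only [H, LinearMap.sub_apply, inner_sub_right, LinearMap.comp_apply, inner_reEnd, h0,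
      hadj', zero_add, sub_zero]
  obtain ⟨M', hdim, hVM, hort, hnn⟩ := exists_nonneg_of_isotropic_le hHs (V := V)
    (fun v hv w hw => by rw [hVH v hv, (hVmem w).1 hw, inner_zero_right, mul_zero])
    (M := M) (fun x hx => by rw [hHre]; linarith [hM x hx])
  -- On `V` the form reduces to `½ ⟪v, N' x⟫`, so form-orthogonality to `V` says `N' x ∈ Vᗮ`. `W` is
  -- stable under `D`, although not under `N`, which is therefore compressed.
  let W : Submodule ℂ F := Vᗮ ⊓ Vᗮ.comap N'
  have hDW : ∀ x ∈ W, D x ∈ W := by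
    rintro x ⟨h1, h2⟩
    refine ⟨hDVo x h1, ?_⟩
    rw [SetLike.mem_coe, Submodule.mem_comap] at h2 ⊢
    rw [hND']
    exact add_mem (hDVo _ h2) h2
  have hMW : Vᗮ ⊓ M' ≤ W := by
    rintro x ⟨h1, h2⟩
    refine ⟨h1, ?_⟩
    rw [SetLike.mem_coe, Submodule.mem_comap, Submodule.mem_orthogonal]
    intro v hv
    have := hort x h2 v hv
    rw [hVH v hv] at this
    simpa using this
  let cmp : Module.End ℂ F → Module.End ℂ W := fun T =>
    (W.orthogonalProjectionOnto : F →ₗ[ℂ] W) ∘ₗ T ∘ₗ W.subtype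
  have hcmp : ∀ (T : Module.End ℂ F) (x y : W), ⟪x, cmp T y⟫_ℂ = ⟪(x : F), T y⟫_ℂ := by
    intro T x y
    exact Submodule.inner_orthogonalProjectionOnto_eq_of_mem_left x (T y)
  have hmove : ∀ x y, ⟪D x, N y⟫_ℂ - ⟪x, N (D y)⟫_ℂ = ⟪x, N y⟫_ℂ := by
    intro x y
    rw [hD, ← inner_sub_right, hN]
  obtain ⟨e, heo, hei⟩ := exists_orthonormal_isotropic_of_graded
    (N := cmp N) (Q := cmp (N ∘ₗ N')) (D := D.restrict hDW)
    (M := (Vᗮ ⊓ M').comap W.subtype)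
    (fun x y => by rw [hcmp, hcmp, hcmp]; exact hmove x y)
    (fun x y => by
      rw [← inner_conj_symm, hcmp, hcmp, inner_conj_symm, LinearMap.comp_apply,
        LinearMap.comp_apply, ← hadj, ← hadj'])
    (fun x y => by
      rw [hcmp, hcmp, LinearMap.comp_apply, LinearMap.comp_apply, ← hadj, ← hadj,
        LinearMap.coe_restrict_apply, LinearMap.coe_restrict_apply, hND', hND', inner_add_left,
        inner_add_right, hD])
    (fun x hx => by
      rw [hcmp, LinearMap.comp_apply, ← hadj]
      -- Definiteness on `W`: a vector of `Vᗮ` killed by `N'` also lies in `V`.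
      have h0 : N' x ≠ 0 := by
        intro h
        have h1 := (Submodule.mem_orthogonal _ _).1 x.2.1 x ((hVmem _).2 h)
        exact hx (Subtype.ext (inner_self_eq_zero.1 h1))
      exact re_inner_self_pos (𝕜 := ℂ) |>.2 h0)
    (fun x hx => by
      have h1 := hnn x hx.2
      rw [hcmp, hcmp, LinearMap.comp_apply, ← hadj]
      rw [hHre] at h1
      linarith)
  let LW : Submodule ℂ W := Submodule.span ℂ (Set.range e)
  have hLW : ∀ x ∈ LW, ∀ y ∈ LW, ⟪(x : F), N y⟫_ℂ = ⟪N' (x : F), N' y⟫_ℂ := by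
    intro x hx y hy
    have h1 := inner_eq_zero_of_mem_span (B := cmp N - cmp (N ∘ₗ N')) hei hx hy
    rw [LinearMap.sub_apply, inner_sub_right, hcmp, hcmp, sub_eq_zero, LinearMap.comp_apply,
      ← hadj _ (N' _)] at h1
    exact h1
  -- Adding `V` back keeps isotropy: `N'` kills `V` and maps `W` into `Vᗮ`, so all cross terms
  -- vanish.
  refine ⟨LW.map W.subtype ⊔ V, ?_, ?_⟩
  · have h1 : Module.finrank ℂ LW = _ := finrank_span_eq_card heo.linearIndependent
    have h2 := Submodule.finrank_map_subtype_eq W LW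
    have h3 := (Submodule.comapSubtypeEquivOfLe hMW).finrank_eq
    have h4 := Submodule.finrank_add_inf_finrank_orthogonal hVM
    have h5 := Submodule.finrank_sup_add_finrank_inf_eq (LW.map W.subtype) V
    have h6 : LW.map W.subtype ⊓ V = ⊥ := by
      rw [eq_bot_iff]
      rintro _ ⟨⟨w, -, rfl⟩, hw⟩
      have := (Submodule.mem_orthogonal _ _).1 w.2.1 w hw
      exact inner_self_eq_zero.1 this
    rw [h6, finrank_bot] at h5
    rw [Fintype.card_fin] at h1
    omega
  · intro x hx y hy
    obtain ⟨_, ⟨a, ha, rfl⟩, v, hv, rfl⟩ := Submodule.mem_sup.1 hx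
    obtain ⟨_, ⟨b, hb, rfl⟩, w, hw, rfl⟩ := Submodule.mem_sup.1 hy
    have h1 : ⟪N' (a : F), w⟫_ℂ = 0 := (Submodule.mem_orthogonal' _ _).1 a.2.2 w hw
    have h2 := hLW a ha b hb
    rw [← hadj] at h2
    rw [hVmem] at hv hw
    rw [inner_sub_right, ← hadj, ← hadj _ (N' _), map_add, hv, map_add, hw, add_zero, add_zero,
      inner_add_right, Submodule.subtype_apply, Submodule.subtype_apply, h1, h2, add_zero,
      sub_self]

end Reduction

/-! ### Inertia and isotropic subspaces of matrices. -/

section Inertia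

theorem isHermitian_hermPart {ι : Type*} (X : Matrix ι ι ℂ) : (hermPart X).IsHermitian := by
  rw [Matrix.IsHermitian, hermPart, Matrix.conjTranspose_smul, Matrix.conjTranspose_add,
    Matrix.conjTranspose_conjTranspose, add_comm]
  simp

variable {ι κ : Type*} [Fintype ι] [Fintype κ]

theorem inner_eq_zero_of_mem_span_image {b : OrthonormalBasis ι ℂ (EuclideanSpace ℂ ι)}
    {s : Finset ι} {x : EuclideanSpace ℂ ι} (hx : x ∈ Submodule.span ℂ (b '' s)) {i : ι}
    (hi : i ∉ s) : ⟪b i, x⟫_ℂ = 0 := by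
  induction hx using Submodule.span_induction with
  | mem x hx =>
    obtain ⟨j, hj, rfl⟩ := hx
    exact b.orthonormal.2 (fun h => hi (h ▸ hj))
  | zero => simp
  | add x y _ _ h1 h2 => rw [inner_add_right, h1, h2, add_zero]
  | smul r x _ h => rw [inner_smul_right, h, mul_zero]

theorem finrank_span_image (b : OrthonormalBasis ι ℂ (EuclideanSpace ℂ ι)) (s : Finset ι) :
    Module.finrank ℂ (Submodule.span ℂ (b '' s)) = s.card := by
  have h := finrank_span_eq_card (R := ℂ) (b := fun i : s => b i)
    (b.orthonormal.linearIndependent.comp _ Subtype.val_injective)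
  have hr : Set.range (fun i : s => b i) = b '' s := by
    ext x; simp
  rw [hr, Fintype.card_coe] at h
  exact h

theorem exists_orthonormalBasis_extending {k r : ℕ} {e : Fin k → EuclideanSpace ℂ ι}
    (heo : Orthonormal ℂ e) (hcard : Fintype.card ι = Fintype.card (Fin k ⊕ Fin r)) :
    ∃ b : OrthonormalBasis (Fin k ⊕ Fin r) ℂ (EuclideanSpace ℂ ι), ∀ i, b (Sum.inl i) = e i := by
  have hres : ∀ v : Fin k ⊕ Fin r → EuclideanSpace ℂ ι, (∀ i, v (Sum.inl i) = e i) →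
      Orthonormal ℂ ((Set.range (Sum.inl : Fin k → Fin k ⊕ Fin r)).domRestrict v) := by
    intro v hv
    constructor
    · rintro ⟨_, i, rfl⟩
      rw [Set.domRestrict_apply, hv]
      exact heo.1 i
    · rintro ⟨_, i, rfl⟩ ⟨_, j, rfl⟩ h
      rw [Set.domRestrict_apply, Set.domRestrict_apply, hv, hv]
      exact heo.2 fun hij => h (Subtype.ext (congrArg Sum.inl hij))
  obtain ⟨b, hb⟩ := (hres (Sum.elim e 0) fun _ => rfl).exists_orthonormalBasis_extension_of_card_eq
    (finrank_euclideanSpace.trans hcard)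
  refine ⟨b, fun i => ?_⟩
  rw [hb _ ⟨i, rfl⟩, Sum.elim_inl]

variable [DecidableEq ι] [DecidableEq κ]

theorem inner_toEuclideanLin_right (X : Matrix ι κ ℂ) (x : EuclideanSpace ℂ ι)
    (y : EuclideanSpace ℂ κ) :
    ⟪x, Matrix.toEuclideanLin X y⟫_ℂ = ⟪Matrix.toEuclideanLin Xᴴ x, y⟫_ℂ := by
  rw [Matrix.toEuclideanLin_conjTranspose_eq_adjoint, LinearMap.adjoint_inner_left]

theorem re_inner_toEuclideanLin_hermPart (X : Matrix ι ι ℂ) (x : EuclideanSpace ℂ ι) :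
    (⟪x, Matrix.toEuclideanLin (hermPart X) x⟫_ℂ).re = (⟪x, Matrix.toEuclideanLin X x⟫_ℂ).re := by
  have h : Matrix.toEuclideanLin (hermPart X) = reEnd (Matrix.toEuclideanLin X) := by
    rw [hermPart, reEnd, map_smul, map_add, Matrix.toEuclideanLin_conjTranspose_eq_adjoint]
  rw [h, re_inner_reEnd_self]

theorem inner_eigenvectorBasis_toEuclideanLin {H : Matrix ι ι ℂ} (hH : H.IsHermitian) (i : ι)
    (x : EuclideanSpace ℂ ι) :
    ⟪hH.eigenvectorBasis i, Matrix.toEuclideanLin H x⟫_ℂ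
      = hH.eigenvalues i * ⟪hH.eigenvectorBasis i, x⟫_ℂ := by
  have h : Matrix.toEuclideanLin H (hH.eigenvectorBasis i)
      = (hH.eigenvalues i : ℂ) • hH.eigenvectorBasis i := by
    ext j
    have := congrFun (hH.mulVec_eigenvectorBasis i) j
    simpa [Matrix.toLpLin_apply] using this
  rw [inner_toEuclideanLin_right, hH.eq, h, inner_smul_left, Complex.conj_ofReal]

theorem re_inner_toEuclideanLin_eq_sum {H : Matrix ι ι ℂ} (hH : H.IsHermitian)
    (x : EuclideanSpace ℂ ι) :
    (⟪x, Matrix.toEuclideanLin H x⟫_ℂ).re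
      = ∑ i, hH.eigenvalues i * Complex.normSq ⟪hH.eigenvectorBasis i, x⟫_ℂ := by
  rw [← hH.eigenvectorBasis.sum_inner_mul_inner, Complex.re_sum]
  refine Finset.sum_congr rfl fun i _ => ?_
  rw [inner_eigenvectorBasis_toEuclideanLin, ← inner_conj_symm x, mul_left_comm,
    ← Complex.normSq_eq_conj_mul_self, ← Complex.ofReal_mul, Complex.ofReal_re]

theorem exists_nonneg_finrank_eq_iNonneg {H : Matrix ι ι ℂ} (hH : H.IsHermitian) :
    ∃ M : Submodule ℂ (EuclideanSpace ℂ ι), Module.finrank ℂ M = iNonneg H ∧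
      ∀ x ∈ M, 0 ≤ (⟪x, Matrix.toEuclideanLin H x⟫_ℂ).re := by
  refine ⟨Submodule.span ℂ (hH.eigenvectorBasis '' (Finset.univ.filter fun i =>
    0 ≤ hH.eigenvalues i : Finset ι)), ?_, fun x hx => ?_⟩
  · rw [finrank_span_image, iNonneg_eq_card hH]
  · rw [re_inner_toEuclideanLin_eq_sum hH]
    refine Finset.sum_nonneg fun i _ => ?_
    by_cases hi : 0 ≤ hH.eigenvalues i
    · exact mul_nonneg hi (Complex.normSq_nonneg _)
    · rw [inner_eq_zero_of_mem_span_image hx (by simpa using hi)]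
      simp

/-- A nonnegative subspace meets the span of the negative eigenvectors trivially. -/
theorem finrank_le_iNonneg {H : Matrix ι ι ℂ} (hH : H.IsHermitian)
    {M : Submodule ℂ (EuclideanSpace ℂ ι)}
    (hM : ∀ x ∈ M, 0 ≤ (⟪x, Matrix.toEuclideanLin H x⟫_ℂ).re) :
    Module.finrank ℂ M ≤ iNonneg H := by
  let s : Finset ι := Finset.univ.filter fun i => hH.eigenvalues i < 0
  let K := Submodule.span ℂ (hH.eigenvectorBasis '' s)
  have hinf : M ⊓ K = ⊥ := by
    rw [eq_bot_iff]
    rintro x ⟨hxM, hxK⟩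
    have h1 := hM x hxM
    rw [re_inner_toEuclideanLin_eq_sum hH] at h1
    have h2 : ∀ i ∈ Finset.univ,
        hH.eigenvalues i * Complex.normSq ⟪hH.eigenvectorBasis i, x⟫_ℂ ≤ 0 := by
      intro i _
      by_cases hi : hH.eigenvalues i < 0
      · exact mul_nonpos_of_nonpos_of_nonneg hi.le (Complex.normSq_nonneg _)
      · rw [inner_eq_zero_of_mem_span_image hxK (by simpa [s] using hi)]
        simp
    have h3 := (Finset.sum_eq_zero_iff_of_nonpos h2).1 (le_antisymm (Finset.sum_nonpos h2) h1)
    have h4 : ∀ i, ⟪hH.eigenvectorBasis i, x⟫_ℂ = 0 := by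
      intro i
      by_cases hi : hH.eigenvalues i < 0
      · exact Complex.normSq_eq_zero.1 ((mul_eq_zero.1 (h3 i (Finset.mem_univ i))).resolve_left
          hi.ne)
      · exact inner_eq_zero_of_mem_span_image hxK (by simpa [s] using hi)
    rw [Submodule.mem_bot]
    rw [← hH.eigenvectorBasis.sum_repr' x]
    simp [h4]
  have h1 := Submodule.finrank_sup_add_finrank_inf_eq M K
  have h2 := Submodule.finrank_le (M ⊔ K)
  have h3 : Module.finrank ℂ K = s.card := finrank_span_image _ _
  rw [hinf, finrank_bot] at h1
  rw [finrank_euclideanSpace] at h2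
  have h4 := Finset.card_filter_add_card_filter_not (s := (Finset.univ : Finset ι))
    (fun i => hH.eigenvalues i < 0)
  rw [iNonneg_eq_card hH]
  simp only [not_lt, Finset.card_univ] at h4
  have h5 : s.card = (Finset.univ.filter fun i => hH.eigenvalues i < 0).card := rfl
  omega

theorem iNonneg_le_of_injective {H : Matrix ι ι ℂ} {H' : Matrix κ κ ℂ} (hH : H.IsHermitian)
    (hH' : H'.IsHermitian) (φ : EuclideanSpace ℂ ι →ₗ[ℂ] EuclideanSpace ℂ κ)
    (hφ : Function.Injective φ)
    (h : ∀ x, 0 ≤ (⟪x, Matrix.toEuclideanLin H x⟫_ℂ).re →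
      0 ≤ (⟪φ x, Matrix.toEuclideanLin H' (φ x)⟫_ℂ).re) :
    iNonneg H ≤ iNonneg H' := by
  obtain ⟨M, hM, hMn⟩ := exists_nonneg_finrank_eq_iNonneg hH
  rw [← hM, (Submodule.equivMapOfInjective φ hφ M).finrank_eq]
  refine finrank_le_iNonneg hH' ?_
  rintro _ ⟨x, hx, rfl⟩
  exact h x (hMn x hx)

theorem toEuclideanLin_mul_apply {μ : Type*} [Fintype μ] (X : Matrix μ ι ℂ) (Y : Matrix ι κ ℂ)
    (x : EuclideanSpace ℂ κ) :
    Matrix.toEuclideanLin (X * Y) x = Matrix.toEuclideanLin X (Matrix.toEuclideanLin Y x) := by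
  simp only [Matrix.toLpLin_apply, Matrix.mulVec_mulVec]

theorem toEuclideanLin_injective_of_mul_eq_one {X : Matrix κ ι ℂ} {Y : Matrix ι κ ℂ}
    (h : X * Y = 1) : Function.Injective (Matrix.toEuclideanLin Y) := by
  refine Function.LeftInverse.injective (g := Matrix.toEuclideanLin X) fun x => ?_
  rw [← toEuclideanLin_mul_apply, h]
  simp

/-- The first `k` columns of the unitary span a space on which the form of `X`, hence that of `Re
X`, vanishes. -/
theorem zeroDilationIndex_le_iNonneg (X : Matrix ι ι ℂ) :
    zeroDilationIndex X ≤ iNonneg (hermPart X) := by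
  have hmem := (isGreatest_zeroDilationIndex X).1
  generalize zeroDilationIndex X = k at hmem ⊢
  obtain ⟨r, Y, Z, T, U, hU, -, hB⟩ := hmem
  let V : Matrix ι (Fin k) ℂ := U.submatrix id Sum.inl
  have hV : Vᴴ * V = 1 := by
    ext i j
    have := congrFun (congrFun hU (Sum.inl i)) (Sum.inl j)
    simpa [V, Matrix.mul_apply, Matrix.one_apply] using this
  have hVX : Vᴴ * X * V = 0 := by
    ext i j
    have := congrFun (congrFun hB (Sum.inl i)) (Sum.inl j)
    simpa [V, Matrix.mul_apply] using this.symm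
  have hinj := toEuclideanLin_injective_of_mul_eq_one hV
  have h1 := LinearMap.finrank_range_of_inj hinj
  rw [finrank_euclideanSpace, Fintype.card_fin] at h1
  rw [← h1]
  refine finrank_le_iNonneg (isHermitian_hermPart X) ?_
  rintro _ ⟨z, rfl⟩
  rw [re_inner_toEuclideanLin_hermPart, ← Matrix.conjTranspose_conjTranspose V,
    ← inner_toEuclideanLin_right, Matrix.conjTranspose_conjTranspose, ← toEuclideanLin_mul_apply,
    ← toEuclideanLin_mul_apply, hVX]
  simp

theorem conjTranspose_mul_mul_apply_eq_inner {μ : Type*} (X : Matrix ι ι ℂ)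
    (b : μ → EuclideanSpace ℂ ι) (i j : μ) :
    ((Matrix.of fun p q => b q p)ᴴ * X * (Matrix.of fun p q => b q p)) i j
      = ⟪b i, Matrix.toEuclideanLin X (b j)⟫_ℂ := by
  rw [EuclideanSpace.inner_eq_star_dotProduct, Matrix.mul_assoc, dotProduct_comm]
  rfl

theorem conjTranspose_mul_self_of_orthonormal {μ : Type*} [DecidableEq μ]
    {b : μ → EuclideanSpace ℂ ι} (hb : Orthonormal ℂ b) :
    (Matrix.of fun p q => b q p : Matrix ι μ ℂ)ᴴ * (Matrix.of fun p q => b q p) = 1 := by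
  ext i j
  have h := conjTranspose_mul_mul_apply_eq_inner (1 : Matrix ι ι ℂ) b i j
  rw [Matrix.mul_one] at h
  rw [h, Matrix.one_apply, ← orthonormal_iff_ite.1 hb i j]
  simp

theorem dilates_zero_of_orthonormal {X : Matrix ι ι ℂ} {k : ℕ} {e : Fin k → EuclideanSpace ℂ ι}
    (heo : Orthonormal ℂ e) (he : ∀ i j, ⟪e i, Matrix.toEuclideanLin X (e j)⟫_ℂ = 0) :
    Dilates (0 : Matrix (Fin k) (Fin k) ℂ) X := by
  have hk : k ≤ Fintype.card ι := by
    simpa using heo.linearIndependent.fintype_card_le_finrank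
  have hcard : Fintype.card ι = Fintype.card (Fin k ⊕ Fin (Fintype.card ι - k)) := by
    rw [Fintype.card_sum, Fintype.card_fin, Fintype.card_fin]
    omega
  generalize Fintype.card ι - k = r at hcard
  obtain ⟨b, hb⟩ := exists_orthonormalBasis_extending heo hcard
  have hU := conjTranspose_mul_self_of_orthonormal b.orthonormal
  have hentry := conjTranspose_mul_mul_apply_eq_inner X b
  generalize (Matrix.of fun p q => b q p : Matrix ι (Fin k ⊕ Fin r) ℂ) = U at hU hentry
  refine ⟨r, (Uᴴ * X * U).toBlocks₁₂, (Uᴴ * X * U).toBlocks₂₁, (Uᴴ * X * U).toBlocks₂₂, U, hU,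
    (Matrix.mul_eq_one_comm_of_card_eq _ _ _ hcard.symm).1 hU, ?_⟩
  have h0 : (0 : Matrix (Fin k) (Fin k) ℂ) = (Uᴴ * X * U).toBlocks₁₁ := by
    ext i j
    rw [Matrix.toBlocks₁₁, Matrix.of_apply, hentry, hb, hb, he]
    rfl
  rw [h0, Matrix.fromBlocks_toBlocks]

theorem finrank_le_zeroDilationIndex {X : Matrix ι ι ℂ} {L : Submodule ℂ (EuclideanSpace ℂ ι)}
    (hL : ∀ x ∈ L, ∀ y ∈ L, ⟪x, Matrix.toEuclideanLin X y⟫_ℂ = 0) :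
    Module.finrank ℂ L ≤ zeroDilationIndex X := by
  obtain ⟨e, heo, heL⟩ := exists_orthonormal_of_le_finrank (le_refl (Module.finrank ℂ L))
  exact (isGreatest_zeroDilationIndex X).2
    (dilates_zero_of_orthonormal heo fun i j => hL _ (heL i) _ (heL j))

end Inertia

/-! ### Inertia under compression, congruence and direct sums. -/

section Submatrix

variable {ι κ : Type*} [Fintype ι] [DecidableEq ι] [Fintype κ] [DecidableEq κ]

theorem one_submatrix_conjTranspose_mul_mul {μ : Type*} (H : Matrix ι ι ℂ) (g : μ → ι) :
    ((1 : Matrix ι ι ℂ).submatrix id g)ᴴ * H * (1 : Matrix ι ι ℂ).submatrix id g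
      = H.submatrix g g := by
  ext i j
  simp [Matrix.mul_apply, Matrix.one_apply]

theorem inner_toEuclideanLin_conj (S : Matrix κ ι ℂ) (Y : Matrix ι ι ℂ)
    (x y : EuclideanSpace ℂ κ) :
    ⟪x, Matrix.toEuclideanLin (S * Y * Sᴴ) y⟫_ℂ
      = ⟪Matrix.toEuclideanLin Sᴴ x, Matrix.toEuclideanLin Y (Matrix.toEuclideanLin Sᴴ y)⟫_ℂ := by
  rw [toEuclideanLin_mul_apply, toEuclideanLin_mul_apply, inner_toEuclideanLin_right]

theorem iNonneg_submatrix_le {H : Matrix ι ι ℂ} (hH : H.IsHermitian) {g : κ → ι}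
    (hg : Function.Injective g) : iNonneg (H.submatrix g g) ≤ iNonneg H := by
  have h := one_submatrix_conjTranspose_mul_mul H g
  have h1 : ((1 : Matrix ι ι ℂ).submatrix id g)ᴴ * (1 : Matrix ι ι ℂ).submatrix id g = 1 := by
    rw [← Matrix.mul_one (((1 : Matrix ι ι ℂ).submatrix id g)ᴴ),
      one_submatrix_conjTranspose_mul_mul]
    exact Matrix.submatrix_one _ hg
  refine iNonneg_le_of_injective (hH.submatrix g) hH _ (toEuclideanLin_injective_of_mul_eq_one h1)
    fun x hx => ?_
  have h2 := inner_toEuclideanLin_conj ((1 : Matrix ι ι ℂ).submatrix id g)ᴴ H x x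
  rw [Matrix.conjTranspose_conjTranspose, h] at h2
  rwa [← h2]

/-- Restricting coordinates to the range of `g` loses nothing on `M`: extension by zero recovers
each vector. -/
theorem finrank_le_iNonneg_submatrix {H : Matrix ι ι ℂ} (hH : H.IsHermitian) {g : κ → ι}
    (hg : Function.Injective g) {M : Submodule ℂ (EuclideanSpace ℂ ι)}
    (hM : ∀ x ∈ M, 0 ≤ (⟪x, Matrix.toEuclideanLin H x⟫_ℂ).re)
    (hsupp : ∀ x ∈ M, ∀ i, i ∉ Set.range g → x i = 0) :
    Module.finrank ℂ M ≤ iNonneg (H.submatrix g g) := by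
  set P : Matrix ι κ ℂ := (1 : Matrix ι ι ℂ).submatrix id g with hP
  have hPP : ∀ x ∈ M, Matrix.toEuclideanLin P (Matrix.toEuclideanLin Pᴴ x) = x := by
    intro x hx
    ext i
    simp only [Matrix.toLpLin_apply, hP, Matrix.conjTranspose_submatrix,
      Matrix.conjTranspose_one]
    have h1 : (1 : Matrix ι ι ℂ).submatrix g id *ᵥ x.ofLp = fun k => x (g k) := by
      ext k
      simp [Matrix.mulVec, dotProduct, Matrix.one_apply]
    rw [h1]
    by_cases hi : i ∈ Set.range g
    · obtain ⟨k, rfl⟩ := hi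
      simp [Matrix.mulVec, dotProduct, Matrix.one_apply, hg.eq_iff]
    · rw [hsupp x hx i hi]
      refine Finset.sum_eq_zero fun k _ => ?_
      change (1 : Matrix ι ι ℂ) i (g k) * _ = 0
      rw [Matrix.one_apply_ne (fun h => hi ⟨k, h.symm⟩), zero_mul]
  have hle : M ≤ (M.map (Matrix.toEuclideanLin Pᴴ)).map (Matrix.toEuclideanLin P) :=
    fun x hx => ⟨_, ⟨x, hx, rfl⟩, hPP x hx⟩
  refine ((Submodule.finrank_mono hle).trans (Submodule.finrank_map_le _ _)).trans
    (finrank_le_iNonneg (hH.submatrix g) ?_)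
  rintro _ ⟨x, hx, rfl⟩
  have h2 := inner_toEuclideanLin_conj Pᴴ H (Matrix.toEuclideanLin Pᴴ x)
    (Matrix.toEuclideanLin Pᴴ x)
  rw [Matrix.conjTranspose_conjTranspose, hPP x hx, hP, one_submatrix_conjTranspose_mul_mul] at h2
  rw [h2]
  exact hM x hx

theorem iNonneg_hermPart_conj_le {S T : Matrix ι ι ℂ} (hST : S * T = 1) (Y : Matrix ι ι ℂ) :
    iNonneg (hermPart (S * Y * Sᴴ)) ≤ iNonneg (hermPart Y) := by
  have h : Tᴴ * Sᴴ = 1 := by rw [← Matrix.conjTranspose_mul, hST, Matrix.conjTranspose_one]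
  refine iNonneg_le_of_injective (isHermitian_hermPart _) (isHermitian_hermPart _) _
    (toEuclideanLin_injective_of_mul_eq_one h) fun x hx => ?_
  rw [re_inner_toEuclideanLin_hermPart, inner_toEuclideanLin_conj] at hx
  rwa [re_inner_toEuclideanLin_hermPart]

theorem isHermitian_two_smul {μ : Type*} {H : Matrix μ μ ℂ} (hH : H.IsHermitian) :
    ((2 : ℂ) • H).IsHermitian := by
  rw [Matrix.IsHermitian, Matrix.conjTranspose_smul, hH.eq]
  simp

theorem iNonneg_two_smul {H : Matrix ι ι ℂ} (hH : H.IsHermitian) :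
    iNonneg ((2 : ℂ) • H) = iNonneg H := by
  have hform : ∀ x, (⟪x, Matrix.toEuclideanLin ((2 : ℂ) • H) x⟫_ℂ).re
      = 2 * (⟪x, Matrix.toEuclideanLin H x⟫_ℂ).re := by
    intro x
    rw [map_smul, LinearMap.smul_apply, inner_smul_right]
    simp
  have h2 := isHermitian_two_smul hH
  refine le_antisymm (iNonneg_le_of_injective h2 hH LinearMap.id Function.injective_id
    fun x hx => ?_) (iNonneg_le_of_injective hH h2 LinearMap.id Function.injective_id
    fun x hx => ?_)
  · rw [hform] at hx
    rw [LinearMap.id_apply]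
    linarith
  · rw [LinearMap.id_apply, hform]
    linarith

theorem iNonneg_fromBlocks_zero (H : Matrix ι ι ℂ) :
    iNonneg (Matrix.fromBlocks H 0 0 (0 : Matrix κ κ ℂ)) = iNonneg H + Fintype.card κ := by
  have h : (Matrix.fromBlocks H 0 0 (0 : Matrix κ κ ℂ)).charpoly
      = H.charpoly * Polynomial.X ^ Fintype.card κ := by
    rw [Matrix.charpoly_fromBlocks_zero₁₂, Matrix.charpoly_zero]
  have hr : (Matrix.fromBlocks H 0 0 (0 : Matrix κ κ ℂ)).charpoly.roots
      = H.charpoly.roots + Multiset.replicate (Fintype.card κ) 0 := by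
    rw [h, Polynomial.roots_mul (mul_ne_zero H.charpoly_monic.ne_zero
      (pow_ne_zero _ Polynomial.X_ne_zero)), Polynomial.roots_X_pow, Multiset.nsmul_singleton]
  have hp : Multiset.countP (fun z : ℂ => z.im = 0 ∧ 0 < z.re)
      (Multiset.replicate (Fintype.card κ) 0) = 0 := by
    rw [Multiset.countP_eq_zero]
    intro z hz
    rw [Multiset.eq_of_mem_replicate hz]
    simp
  unfold iNonneg iPos iZero
  rw [hr, Multiset.countP_add, Multiset.count_add, hp, Multiset.count_replicate_self]
  omega

end Submatrix

/-! ### Congruence of the KMS matrix to `N - N N*`. -/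

section KMS

variable {m n : ℕ}

theorem jordanBlock_zero_apply (i j : Fin m) :
    jordanBlock m 0 i j = if (i : ℕ) + 1 = j then 1 else 0 := by
  rw [jordanBlock, Matrix.of_apply]
  split_ifs with h1 h2 <;> first | rfl | (subst h1; omega)

theorem jordanBlock_mul_conjTranspose (m : ℕ) :
    jordanBlock m 0 * (jordanBlock m 0)ᴴ = idDirectSumZero m := by
  ext i j
  rw [Matrix.mul_apply, idDirectSumZero, Matrix.diagonal_apply]
  simp only [Matrix.conjTranspose_apply, jordanBlock_zero_apply]
  by_cases hi : (i : ℕ) + 1 < m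
  · rw [Finset.sum_eq_single ⟨i + 1, hi⟩]
    · by_cases hij : i = j
      · simp [hij, hij ▸ hi]
      · have : (i : ℕ) ≠ j := fun h => hij (Fin.ext h)
        simp [hij, Ne.symm this]
    · intro k _ hk
      rw [if_neg, zero_mul]
      exact fun h => hk (Fin.ext h.symm)
    · simp
  · rw [if_neg hi, ite_self]
    refine Finset.sum_eq_zero fun k _ => ?_
    rw [if_neg, zero_mul]
    have := k.2
    omega

theorem kronecker_mul_conjTranspose (A : Matrix (Fin n) (Fin n) ℂ) :
    (jordanBlock m 0 ⊗ₖ A) * (jordanBlock m 0 ⊗ₖ A)ᴴ = idDirectSumZero m ⊗ₖ (A * Aᴴ) := by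
  rw [Matrix.conjTranspose_kronecker, ← Matrix.mul_kronecker_mul, jordanBlock_mul_conjTranspose]

/-- The geometric series identity `N (N + N² + ⋯) = N² + N³ + ⋯` for the nilpotent `N = J ⊗ A`. -/
theorem kronecker_mul_kms (A : Matrix (Fin n) (Fin n) ℂ) :
    (jordanBlock m 0 ⊗ₖ A) * kms m A = kms m A - jordanBlock m 0 ⊗ₖ A := by
  ext ⟨i, a⟩ ⟨j, b⟩
  rw [Matrix.mul_apply, Fintype.sum_prod_type, Matrix.sub_apply, Matrix.kroneckerMap_apply]
  simp only [Matrix.kroneckerMap_apply, jordanBlock_zero_apply, kms, Matrix.of_apply, ite_mul,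
    one_mul, zero_mul]
  by_cases hi : (i : ℕ) + 1 < m
  · rw [Finset.sum_eq_single ⟨i + 1, hi⟩]
    · simp only [if_true, Fin.lt_def]
      rcases lt_trichotomy ((i : ℕ) + 1) j with h | h | h
      · have h' : (i : ℕ) < j := by omega
        have h2 : (j : ℕ) - i = (j - (i + 1)) + 1 := by omega
        simp only [h, h', h.ne, if_true, if_false, sub_zero]
        rw [h2, pow_succ', Matrix.mul_apply]
      · have h' : (i : ℕ) < j := by omega
        have h2 : (j : ℕ) - i = 1 := by omega
        simp [h, h', h2]
      · have h' : ¬ (i : ℕ) < j := by omega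
        simp [h.not_gt, h', h.ne']
    · intro k _ hk
      refine Finset.sum_eq_zero fun c _ => ?_
      rw [if_neg]
      exact fun h => hk (Fin.ext h.symm)
    · simp
  · have hj := j.2
    have h1 : ¬ i < j := by rw [Fin.lt_def]; omega
    have h2 : ¬ (i : ℕ) + 1 = j := by omega
    rw [if_neg h1, if_neg h2, sub_zero]
    refine Finset.sum_eq_zero fun k _ => Finset.sum_eq_zero fun c _ => ?_
    have := k.2
    rw [if_neg]
    omega

theorem one_sub_mul_one_add_kms (A : Matrix (Fin n) (Fin n) ℂ) :
    (1 - jordanBlock m 0 ⊗ₖ A) * (1 + kms m A) = 1 := by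
  rw [sub_mul, one_mul, mul_add, mul_one, kronecker_mul_kms]
  abel

theorem one_sub_mul_kms_mul (A : Matrix (Fin n) (Fin n) ℂ) :
    (1 - jordanBlock m 0 ⊗ₖ A) * kms m A * (1 - jordanBlock m 0 ⊗ₖ A)ᴴ
      = jordanBlock m 0 ⊗ₖ A - (jordanBlock m 0 ⊗ₖ A) * (jordanBlock m 0 ⊗ₖ A)ᴴ := by
  rw [sub_mul 1, one_mul, kronecker_mul_kms, sub_sub_cancel, Matrix.conjTranspose_sub,
    Matrix.conjTranspose_one, mul_sub, mul_one]

theorem two_smul_hermPart_sub {ι : Type*} [Fintype ι] (N : Matrix ι ι ℂ) :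
    (2 : ℂ) • hermPart N - (2 : ℂ) • (N * Nᴴ) = (2 : ℂ) • hermPart (N - N * Nᴴ) := by
  rw [← smul_sub]
  congr 1
  rw [hermPart, hermPart, Matrix.conjTranspose_sub, Matrix.conjTranspose_mul,
    Matrix.conjTranspose_conjTranspose]
  module

theorem iNonneg_hermPart_kms (A : Matrix (Fin n) (Fin n) ℂ) :
    iNonneg (hermPart (kms m A)) = iNonneg (hermPart (jordanBlock m 0 ⊗ₖ A
      - (jordanBlock m 0 ⊗ₖ A) * (jordanBlock m 0 ⊗ₖ A)ᴴ)) := by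
  have h1 := one_sub_mul_one_add_kms (m := m) A
  have h2 := mul_eq_one_comm.1 h1
  rw [← one_sub_mul_kms_mul]
  refine le_antisymm ?_ (iNonneg_hermPart_conj_le h1 _)
  set R := 1 - jordanBlock m 0 ⊗ₖ A
  set S := 1 + kms m A
  have h3 : Rᴴ * Sᴴ = 1 := by rw [← Matrix.conjTranspose_mul, h2, Matrix.conjTranspose_one]
  have h4 : kms m A = S * (R * kms m A * Rᴴ) * Sᴴ := by
    rw [mul_assoc, mul_assoc (R * kms m A), h3, mul_one, ← mul_assoc, h2, one_mul]
  calc iNonneg (hermPart (kms m A)) = iNonneg (hermPart (S * (R * kms m A * Rᴴ) * Sᴴ)) := by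
        rw [← h4]
    _ ≤ _ := iNonneg_hermPart_conj_le h2 _

/-- `N` couples block `i` to block `i + 1`, so weight `-i` on block `i` gives it degree `+1`. -/
theorem diagonal_mul_kronecker_sub (A : Matrix (Fin n) (Fin n) ℂ) :
    (Matrix.diagonal fun p : Fin m × Fin n => -((p.1 : ℕ) : ℂ)) * (jordanBlock m 0 ⊗ₖ A)
      - (jordanBlock m 0 ⊗ₖ A) * (Matrix.diagonal fun p : Fin m × Fin n => -((p.1 : ℕ) : ℂ))
      = jordanBlock m 0 ⊗ₖ A := by
  ext ⟨i, a⟩ ⟨j, b⟩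
  rw [Matrix.sub_apply, Matrix.diagonal_mul, Matrix.mul_diagonal, Matrix.kroneckerMap_apply,
    jordanBlock_zero_apply]
  split_ifs with h
  · rw [← h]
    push_cast
    ring
  · simp

theorem iNonneg_hermPart_kms_le (A : Matrix (Fin n) (Fin n) ℂ) :
    iNonneg (hermPart (kms m A)) ≤ zeroDilationIndex (kms m A) := by
  rw [iNonneg_hermPart_kms]
  obtain ⟨M, hM, hMn⟩ := exists_nonneg_finrank_eq_iNonneg (isHermitian_hermPart
    (jordanBlock m 0 ⊗ₖ A - (jordanBlock m 0 ⊗ₖ A) * (jordanBlock m 0 ⊗ₖ A)ᴴ))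
  rw [← hM]
  have hgr := diagonal_mul_kronecker_sub (m := m) A
  have hform := one_sub_mul_kms_mul (m := m) A
  have hinv : (1 + kms m A)ᴴ * (1 - jordanBlock m 0 ⊗ₖ A)ᴴ = 1 := by
    rw [← Matrix.conjTranspose_mul, one_sub_mul_one_add_kms, Matrix.conjTranspose_one]
  generalize (1 - jordanBlock m 0 ⊗ₖ A) = R at hform hinv
  generalize jordanBlock m 0 ⊗ₖ A = N at *
  have hNN : ∀ x, Matrix.toEuclideanLin (N - N * Nᴴ) x = Matrix.toEuclideanLin N x
      - Matrix.toEuclideanLin N (LinearMap.adjoint (Matrix.toEuclideanLin N) x) := by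
    intro x
    rw [← Matrix.toEuclideanLin_conjTranspose_eq_adjoint, ← toEuclideanLin_mul_apply, map_sub,
      LinearMap.sub_apply]
  have hDs : (Matrix.toEuclideanLin
      (Matrix.diagonal fun p : Fin m × Fin n => -((p.1 : ℕ) : ℂ))).IsSymmetric := by
    rw [Matrix.isSymmetric_toEuclideanLin_iff, Matrix.IsHermitian,
      Matrix.diagonal_conjTranspose]
    congr 1
    ext p
    simp
  obtain ⟨L, hL, hiso⟩ := exists_isotropic_of_graded (N := Matrix.toEuclideanLin N) hDs
    (fun x => by
      rw [← toEuclideanLin_mul_apply, ← toEuclideanLin_mul_apply, ← LinearMap.sub_apply,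
        ← map_sub, hgr])
    (M := M) (fun x hx => by
      have h := hMn x hx
      rw [re_inner_toEuclideanLin_hermPart, hNN, inner_sub_right, Complex.sub_re,
        ← LinearMap.adjoint_inner_left _ (LinearMap.adjoint (Matrix.toEuclideanLin N) x) x] at h
      linarith)
  -- If `L` is isotropic for `R K R*`, its image under the injective `R*` is isotropic for `K`, of
  -- the same dimension.
  have hfin := (Submodule.equivMapOfInjective _
    (toEuclideanLin_injective_of_mul_eq_one hinv) L).finrank_eq
  refine hL.trans (hfin.le.trans (finrank_le_zeroDilationIndex ?_))
  rintro _ ⟨x, hx, rfl⟩ _ ⟨y, hy, rfl⟩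
  rw [← inner_toEuclideanLin_conj, hform, hNN]
  exact hiso x hx y hy

end KMS

/-! ### Deleting a block when `A` is invertible. -/

section Nonsingular

variable {k n : ℕ}

/-- The matrix `2 Re (J_m(0) ⊗ A) - 2 (I_{m-1} ⊕ [0]) ⊗ A A*`. -/
noncomputable def reducedForm (m : ℕ) (A : Matrix (Fin n) (Fin n) ℂ) :
    Matrix (Fin m × Fin n) (Fin m × Fin n) ℂ :=
  (2 : ℂ) • hermPart (jordanBlock m 0 ⊗ₖ A) - (2 : ℂ) • (idDirectSumZero m ⊗ₖ (A * Aᴴ))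

theorem reducedForm_eq (m : ℕ) (A : Matrix (Fin n) (Fin n) ℂ) :
    reducedForm m A = (2 : ℂ) • hermPart (jordanBlock m 0 ⊗ₖ A
      - (jordanBlock m 0 ⊗ₖ A) * (jordanBlock m 0 ⊗ₖ A)ᴴ) := by
  rw [reducedForm, ← kronecker_mul_conjTranspose, two_smul_hermPart_sub]

theorem isHermitian_reducedForm (m : ℕ) (A : Matrix (Fin n) (Fin n) ℂ) :
    (reducedForm m A).IsHermitian := by
  rw [reducedForm_eq]
  exact isHermitian_two_smul (isHermitian_hermPart _)

theorem iNonneg_hermPart_kms_eq_reducedForm (m : ℕ) (A : Matrix (Fin n) (Fin n) ℂ) :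
    iNonneg (hermPart (kms m A)) = iNonneg (reducedForm m A) := by
  rw [reducedForm_eq, iNonneg_two_smul (isHermitian_hermPart _), iNonneg_hermPart_kms]

theorem reducedForm_apply (m : ℕ) (A : Matrix (Fin n) (Fin n) ℂ) (i j : Fin m) (a b : Fin n) :
    reducedForm m A (i, a) (j, b) = (if (i : ℕ) + 1 = j then A a b else 0)
      + (if (j : ℕ) + 1 = i then star (A b a) else 0)
      - 2 * (if i = j ∧ (i : ℕ) + 1 < m then (A * Aᴴ) a b else 0) := by
  simp only [reducedForm, hermPart, idDirectSumZero, Matrix.sub_apply, Matrix.smul_apply,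
    Matrix.add_apply, Matrix.conjTranspose_apply, Matrix.kroneckerMap_apply,
    jordanBlock_zero_apply, Matrix.diagonal_apply, smul_eq_mul, ite_mul, one_mul, zero_mul,
    ite_and, apply_ite star, star_zero]
  ring

/-- The indices outside of the last but one block. -/
def skipBlock (k n : ℕ) : Fin k × Fin n ⊕ Fin n → Fin (k + 2) × Fin n :=
  Sum.elim (fun p => (p.1.castAdd 2, p.2)) fun a => (Fin.last (k + 1), a)

theorem skipBlock_injective : Function.Injective (skipBlock k n) := by
  rintro (⟨i, a⟩ | a) (⟨j, b⟩ | b) h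
  · simp only [skipBlock, Sum.elim_inl, Prod.mk.injEq] at h
    rw [Fin.castAdd_injective _ _ h.1, h.2]
  · simp only [skipBlock, Sum.elim_inl, Sum.elim_inr, Prod.mk.injEq, Fin.ext_iff] at h
    have := i.2
    simp at h
    omega
  · simp only [skipBlock, Sum.elim_inl, Sum.elim_inr, Prod.mk.injEq, Fin.ext_iff] at h
    have := j.2
    simp at h
    omega
  · simp only [skipBlock, Sum.elim_inr, Prod.mk.injEq] at h
    rw [h.2]

theorem fst_eq_of_notMem_range_skipBlock {p : Fin (k + 2) × Fin n}
    (hp : p ∉ Set.range (skipBlock k n)) : (p.1 : ℕ) = k := by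
  obtain ⟨i, a⟩ := p
  have hi := i.2
  rcases lt_trichotomy (i : ℕ) k with h | h | h
  · exact absurd ⟨Sum.inl (⟨i, h⟩, a), rfl⟩ hp
  · exact h
  · refine absurd ⟨Sum.inr a, ?_⟩ hp
    simp only [skipBlock, Sum.elim_inr, Prod.mk.injEq, and_true]
    ext
    rw [Fin.val_last]
    omega

/-- The last block has no `A A*` term and is coupled only to the deleted block, so it splits off as
a zero summand; the first `k` blocks all keep their `A A*` term. -/
theorem reducedForm_submatrix (A : Matrix (Fin n) (Fin n) ℂ) :
    (reducedForm (k + 2) A).submatrix (skipBlock k n) (skipBlock k n)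
      = Matrix.fromBlocks ((2 : ℂ) • hermPart (jordanBlock k 0 ⊗ₖ A)
          - (2 : ℂ) • ((1 : Matrix (Fin k) (Fin k) ℂ) ⊗ₖ (A * Aᴴ))) 0 0 0 := by
  ext (⟨i, a⟩ | a) (⟨j, b⟩ | b)
  · have h : (i : ℕ) + 1 < k + 2 := by omega
    simp only [Matrix.submatrix_apply, skipBlock, Sum.elim_inl, reducedForm_apply,
      Matrix.fromBlocks_apply₁₁, hermPart, Matrix.sub_apply, Matrix.smul_apply,
      Matrix.add_apply, Matrix.conjTranspose_apply, Matrix.kroneckerMap_apply,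
      jordanBlock_zero_apply, Matrix.one_apply, smul_eq_mul, ite_mul, one_mul, zero_mul,
      apply_ite star, star_zero, Fin.val_castAdd, h, and_true,
      (Fin.castAdd_injective k 2).eq_iff]
    ring
  · have hi := i.2
    have h1 : ¬ ((i : ℕ) + 1 = k + 1) := by omega
    have h2 : ¬ (k + 1 + 1 = (i : ℕ)) := by omega
    have h3 : ¬ ((i : ℕ) = k + 1) := by omega
    simp [skipBlock, reducedForm_apply, Fin.ext_iff, h2, h3, hi.ne]
  · have hj := j.2
    have h2 : ¬ (k + 1 + 1 = (j : ℕ)) := by omega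
    have h3 : ¬ (k + 1 = (j : ℕ)) := by omega
    simp [skipBlock, reducedForm_apply, Fin.ext_iff, h2, h3, hj.ne]
  · simp [skipBlock, reducedForm_apply]

theorem iNonneg_reducedForm_le {A : Matrix (Fin n) (Fin n) ℂ} (hA : IsUnit A) :
    iNonneg (reducedForm (k + 2) A)
      ≤ iNonneg ((reducedForm (k + 2) A).submatrix (skipBlock k n) (skipBlock k n)) := by
  have hH := isHermitian_reducedForm (k + 2) A
  obtain ⟨M, hM, hMn⟩ := exists_nonneg_finrank_eq_iNonneg hH
  let e : Fin n → EuclideanSpace ℂ (Fin (k + 2) × Fin n) := fun a =>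
    EuclideanSpace.single (Fin.last (k + 1), a) 1
  have he : ∀ a x, ⟪e a, Matrix.toEuclideanLin (reducedForm (k + 2) A) x⟫_ℂ
      = (reducedForm (k + 2) A *ᵥ x.ofLp) (Fin.last (k + 1), a) := by
    intro a x
    rw [EuclideanSpace.inner_single_left, map_one, one_mul]
    rfl
  have hee : ∀ a b, ⟪e a, Matrix.toEuclideanLin (reducedForm (k + 2) A) (e b)⟫_ℂ = 0 := by
    intro a b
    rw [he]
    simp [e, reducedForm_apply]
  obtain ⟨M', hdim, -, hort, hnn⟩ := exists_nonneg_of_isotropic_le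
    (Matrix.isSymmetric_toEuclideanLin_iff.2 hH) (V := Submodule.span ℂ (Set.range e))
    (fun v hv w hw => inner_eq_zero_of_mem_span hee hv hw) hMn
  rw [← hM]
  refine hdim.trans (finrank_le_iNonneg_submatrix hH skipBlock_injective hnn ?_)
  intro x hx
  let kk : Fin (k + 2) := ⟨k, by omega⟩
  -- The rows of the last block contain only `A*`, in block column `k`, so form-orthogonality to the
  -- last block reads `A* x_k = 0`.
  have hmul : Aᴴ *ᵥ (fun c => x (kk, c)) = 0 := by
    ext a
    have h := hort x hx (e a) (Submodule.subset_span ⟨a, rfl⟩)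
    rw [he, Matrix.mulVec, dotProduct, Fintype.sum_prod_type,
      Finset.sum_eq_single kk] at h
    · rw [Matrix.mulVec, dotProduct, Pi.zero_apply, ← h]
      refine Finset.sum_congr rfl fun c _ => ?_
      have h2 : ¬ (k + 1 + 1 = k) := by omega
      simp [reducedForm_apply, kk, Fin.ext_iff, h2]
    · intro j _ hj
      refine Finset.sum_eq_zero fun c _ => ?_
      have h1 : ¬ (j : ℕ) = k := fun h => hj (Fin.ext h)
      have h2 : ¬ (k + 1 + 1 = (j : ℕ)) := by omega
      simp [reducedForm_apply, h1, h2]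
    · simp
  have hzero : (fun c => x (kk, c)) = 0 := by
    have hinj := Matrix.mulVec_injective_of_isUnit ((Matrix.isUnit_conjTranspose A).2 hA)
    exact hinj (hmul.trans (Matrix.mulVec_zero _).symm)
  rintro ⟨i, a⟩ hi
  have h1 : i = kk := Fin.ext (fst_eq_of_notMem_range_skipBlock hi)
  rw [h1]
  exact congrFun hzero a

end Nonsingular

end ZeroDilation

theorem mainTheorem3 (m n : ℕ) (hm : 3 ≤ m) (A : Matrix (Fin n) (Fin n) ℂ) :
    ZeroDilation.zeroDilationIndex (ZeroDilation.kms m A)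
        = ZeroDilation.iNonneg (ZeroDilation.hermPart (ZeroDilation.kms m A)) ∧
    ZeroDilation.iNonneg (ZeroDilation.hermPart (ZeroDilation.kms m A))
        = ZeroDilation.iNonneg
            ((2 : ℂ) • ZeroDilation.hermPart (ZeroDilation.jordanBlock m 0 ⊗ₖ A)
              - (2 : ℂ) • (ZeroDilation.idDirectSumZero m ⊗ₖ (A * Aᴴ))) ∧
    (IsUnit A →
      ZeroDilation.zeroDilationIndex (ZeroDilation.kms m A)
        = n + ZeroDilation.iNonneg
            ((2 : ℂ) • ZeroDilation.hermPart (ZeroDilation.jordanBlock (m - 2) 0 ⊗ₖ A)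
              - (2 : ℂ) • ((1 : Matrix (Fin (m - 2)) (Fin (m - 2)) ℂ) ⊗ₖ (A * Aᴴ)))) := by
  have h1 := le_antisymm (ZeroDilation.zeroDilationIndex_le_iNonneg (ZeroDilation.kms m A))
    (ZeroDilation.iNonneg_hermPart_kms_le A)
  have h2 := ZeroDilation.iNonneg_hermPart_kms_eq_reducedForm m A
  refine ⟨h1, h2, fun hA => ?_⟩
  obtain ⟨k, rfl⟩ : ∃ k, m = k + 2 := ⟨m - 2, by omega⟩
  -- Deleting the block cannot raise the index, and for invertible `A` it does not lower it.
  rw [h1, h2, le_antisymm (ZeroDilation.iNonneg_reducedForm_le hA)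
    (ZeroDilation.iNonneg_submatrix_le (ZeroDilation.isHermitian_reducedForm (k + 2) A)
      ZeroDilation.skipBlock_injective), ZeroDilation.reducedForm_submatrix,
    ZeroDilation.iNonneg_fromBlocks_zero, Fintype.card_fin, add_comm]
  rfl
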